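/- Notation. For a Radon measure $\mu$ on $\mathbb R^d$ put $E=\operatorname{supp}\mu$; balls $B(x,r)$ are closed, $\lambda B(x,r)=B(x,\lambda r)$, and $\theta_\mu(B(x,r))=\mu(B(x,r))/r^n$. We say that $\mu$ has polynomial growth of degree $n$ if there is $\theta_0<\infty$ with $\mu(B(x,r))\le\theta_0 r^n$ for all $x\in E$, $r>0$. For constants $c>0$, $C_0>1$, $A_0>5000\,C_0$, a David–Mattila lattice $\mathcal D_\mu=\bigcup_{k\ge0}\mathcal D_{\mu,k}$ of $\mu$ (a cube being a set together with its generation $k$) is a sequence of partitions $\mathcal D_{\mu,k}$, $k=0,1,2,\dots$, of $E$ into Borel sets ("cubes") such that: - if $k<l$, $Q\in\mathcal D_{\mu,l}$, $R\in\mathcal D_{\mu,k}$, then $Q\cap R=\varnothing$ or $Q\subset R$; - each $Q\in\mathcal D_{\mu,k}$ has a ball $B(Q)=B(x_Q,r(Q))$ with $x_Q\in E$, $A_0^{-k}\le r(Q)\le C_0A_0^{-k}$ and $E\cap B(Q)\subset Q\subset 28B(Q)$, and the balls $5B(Q)$, $Q\in\mathcal D_{\mu,k}$, are pairwise disjoint;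 - (small boundaries) for $Q\in\mathcal D_{\mu,k}$ and each integer $l\ge0$, the set $$N_l(Q)=\{x\in E\setminus Q:\operatorname{dist}(x,Q)<A_0^{-k-l}\}\cup\{x\in Q:\operatorname{dist}(x,E\setminus Q)<A_0^{-k-l}\}$$ satisfies $\mu(N_l(Q))\le (c^{-1}C_0^{-3d-1}A_0)^{-l}\,\mu(90B(Q))$ (with $\operatorname{dist}(x,\varnothing)=\infty$); - if $Q\in\mathcal D_{\mu,k}$ and $\mu(100B(Q))>C_0\,\mu(B(Q))$, then $r(Q)=A_0^{-k}$ and $\mu(100B(Q))\le C_0^{-l}\mu(100^{l+1}B(Q))$ for all integers $l\ge1$ with $100^l\le C_0$. For $Q\in\mathcal D_{\mu,k}$ put $\ell(Q)=56\,C_0A_0^{-k}$ and $B_Q=28B(Q)$, and let $2Q$ be the union of the cubes $P\in\mathcal D_{\mu,k}$ with $\operatorname{dist}(x_Q,P)\le 2\ell(Q)$. Lemma. For every $d$ there is a constant $c=c(d)>0$ such that for every integer $n\ge0$ and every $\gamma\in(0,1)$ there is $K=K(d,n,\gamma)\in\mathbb N$ such that for every $A_0$ there is a finite constant $C=C(d,n,\gamma,A_0)$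 with the following property. Let $C_0>1$ be such that $A_0>5000\,C_0$ and $A_0\ge K C_0^K$, and let $\mu$ be a compactly supported Radon measure on $\mathbb R^d$ with polynomial growth of degree $n$. Then $\mu$ has a David–Mattila lattice $\mathcal D_\mu$ with constants $c,C_0,A_0$ such that, for all $Q\in\mathcal D_\mu$, $$\int_{2B_Q\setminus Q}\Big(\int_Q\frac{d\mu(y)}{|x-y|^n}\Big)^2d\mu(x)+\int_Q\Big(\int_{2B_Q\setminus Q}\frac{d\mu(y)}{|x-y|^n}\Big)^2d\mu(x)\le C\sum_{\substack{P\in\mathcal D_\mu:\,P\subset2Q\\ \ell(P)\le\ell(Q)}}\Big(\frac{\ell(P)}{\ell(Q)}\Big)^{\gamma}\theta_\mu(2B_P)^2\,\mu(P)<\infty .$$ In particular $C$ does not depend on $\mu$ or on the growth constant $\theta_0$. -/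

import Mathlib

open MeasureTheory Metric Set
open scoped ENNReal NNReal

noncomputable section

/-- The `n`-dimensional density `θ_μ(B) = μ(B) / r(B)^n` of the ball `B = B(x, r)`. -/
def ballDensity {d : ℕ} (μ : Measure (EuclideanSpace ℝ (Fin d))) (n : ℕ)
    (x : EuclideanSpace ℝ (Fin d)) (r : ℝ) : ℝ≥0∞ :=
  μ (closedBall x r) / ENNReal.ofReal r ^ n

/-- Polynomial growth of degree `n`: there is a finite `θ₀` with `μ(B(x,r)) ≤ θ₀ r^n` for all
`x ∈ supp μ` and all `r > 0`. -/
def HasPolynomialGrowth {d : ℕ} (μ : Measure (EuclideanSpace ℝ (Fin d))) (n : ℕ) : Prop :=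
  ∃ θ₀ : ℝ≥0, ∀ x ∈ μ.support, ∀ r : ℝ, 0 < r →
    μ (closedBall x r) ≤ θ₀ * ENNReal.ofReal r ^ n

/-- A David–Mattila lattice of a measure `μ` on `ℝ^d`, with parameters `C₀`, `A₀` and with the
constant `c` in the small boundary condition. Here `E = supp μ`, and a cube is a set together with
its generation: the same set may be a cube of several generations. The ball of the cube
`Q ∈ cubes k` is `B(Q) = closedBall (center k Q) (radius k Q)`; the values of `center` and `radius`
outside the lattice are irrelevant. -/
structure DMLattice {d : ℕ} (μ : Measure (EuclideanSpace ℝ (Fin d))) (c C₀ A₀ : ℝ) where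
  /-- The family of cubes of generation `k`. -/
  cubes : ℕ → Set (Set (EuclideanSpace ℝ (Fin d)))
  /-- The center `x_Q`. -/
  center : ℕ → Set (EuclideanSpace ℝ (Fin d)) → EuclideanSpace ℝ (Fin d)
  /-- The radius `r(Q)`. -/
  radius : ℕ → Set (EuclideanSpace ℝ (Fin d)) → ℝ
  measurableSet_cube : ∀ k, ∀ Q ∈ cubes k, MeasurableSet Q
  /-- The cubes of generation `k` cover `E` and are contained in it. -/
  sUnion_cubes : ∀ k, ⋃₀ cubes k = μ.support
  /-- Distinct cubes of the same generation are disjoint. -/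
  disjoint_cubes : ∀ k, (cubes k).PairwiseDisjoint id
  nested : ∀ k l, k < l → ∀ Q ∈ cubes l, ∀ R ∈ cubes k, Disjoint Q R ∨ Q ⊆ R
  center_mem : ∀ k, ∀ Q ∈ cubes k, center k Q ∈ μ.support
  le_radius : ∀ k, ∀ Q ∈ cubes k, (A₀ ^ k)⁻¹ ≤ radius k Q
  radius_le : ∀ k, ∀ Q ∈ cubes k, radius k Q ≤ C₀ * (A₀ ^ k)⁻¹
  /-- `E ∩ B(Q) ⊆ Q`. -/
  ball_subset : ∀ k, ∀ Q ∈ cubes k, μ.support ∩ closedBall (center k Q) (radius k Q) ⊆ Q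
  /-- `Q ⊆ 28 B(Q)`. -/
  subset_ball : ∀ k, ∀ Q ∈ cubes k, Q ⊆ closedBall (center k Q) (28 * radius k Q)
  /-- The balls `5 B(Q)`, with `Q` of generation `k`, are disjoint. -/
  disjoint_balls : ∀ k,
    (cubes k).PairwiseDisjoint fun Q => closedBall (center k Q) (5 * radius k Q)
  /-- Small boundaries: `μ(N_l(Q)) ≤ (c⁻¹ C₀^{-3d-1} A₀)^{-l} μ(90 B(Q))`, where `N_l(Q)` is the
  set of the points of `E ∖ Q` at distance less than `A₀^{-k-l}` from `Q` and of the points of `Q`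
  at distance less than `A₀^{-k-l}` from `E ∖ Q` (there are none of the latter if `E ∖ Q = ∅`). -/
  small_boundary : ∀ k, ∀ Q ∈ cubes k, ∀ l : ℕ,
    μ (((μ.support \ Q) ∩ thickening (A₀ ^ (k + l))⁻¹ Q) ∪
        (Q ∩ thickening (A₀ ^ (k + l))⁻¹ (μ.support \ Q))) ≤
      ENNReal.ofReal (((c⁻¹ * (C₀ ^ (3 * d + 1))⁻¹ * A₀) ^ l)⁻¹) *
        μ (closedBall (center k Q) (90 * radius k Q))
  /-- If `Q` is not doubling, i.e. `μ(100 B(Q)) > C₀ μ(B(Q))`, then `r(Q) = A₀^{-k}`. -/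
  radius_eq_of_not_doubling : ∀ k, ∀ Q ∈ cubes k,
    ¬ μ (closedBall (center k Q) (100 * radius k Q)) ≤
      ENNReal.ofReal C₀ * μ (closedBall (center k Q) (radius k Q)) →
    radius k Q = (A₀ ^ k)⁻¹
  /-- If `Q` is not doubling, then `μ(100 B(Q)) ≤ C₀^{-l} μ(100^{l+1} B(Q))` whenever `l ≥ 1` and
  `100^l ≤ C₀`. -/
  growth_of_not_doubling : ∀ k, ∀ Q ∈ cubes k,
    ¬ μ (closedBall (center k Q) (100 * radius k Q)) ≤
      ENNReal.ofReal C₀ * μ (closedBall (center k Q) (radius k Q)) →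
    ∀ l : ℕ, 1 ≤ l → (100 : ℝ) ^ l ≤ C₀ →
      μ (closedBall (center k Q) (100 * radius k Q)) ≤
        ENNReal.ofReal ((C₀ ^ l)⁻¹) * μ (closedBall (center k Q) (100 ^ (l + 1) * radius k Q))

namespace DMLattice

variable {d : ℕ} {μ : Measure (EuclideanSpace ℝ (Fin d))} {c C₀ A₀ : ℝ}

/-- The side length `ℓ(Q) = 56 C₀ A₀^{-k}` of the cubes of generation `k`. -/
def sideLength (_L : DMLattice μ c C₀ A₀) (k : ℕ) : ℝ := 56 * C₀ * (A₀ ^ k)⁻¹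

/-- The ball `2 B_Q`, where `B_Q = 28 B(Q)`. -/
def twoBall (L : DMLattice μ c C₀ A₀) (k : ℕ) (Q : Set (EuclideanSpace ℝ (Fin d))) :
    Set (EuclideanSpace ℝ (Fin d)) :=
  closedBall (L.center k Q) (2 * (28 * L.radius k Q))

/-- The density `θ_μ(2 B_Q)`. -/
def twoBallDensity (L : DMLattice μ c C₀ A₀) (n k : ℕ)
    (Q : Set (EuclideanSpace ℝ (Fin d))) : ℝ≥0∞ :=
  ballDensity μ n (L.center k Q) (2 * (28 * L.radius k Q))

/-- The set `2Q`: the union of the cubes `P` of the generation `k` of `Q` with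
`dist(x_Q, P) ≤ 2 ℓ(Q)`. -/
def double (L : DMLattice μ c C₀ A₀) (k : ℕ) (Q : Set (EuclideanSpace ℝ (Fin d))) :
    Set (EuclideanSpace ℝ (Fin d)) :=
  ⋃₀ {P | P ∈ L.cubes k ∧ infDist (L.center k Q) P ≤ 2 * L.sideLength k}

/-- The family of the cubes `P ⊆ 2Q` with `ℓ(P) ≤ ℓ(Q)`, each recorded as a pair
`(generation, set)`. -/
def cubesInDouble (L : DMLattice μ c C₀ A₀) (k : ℕ) (Q : Set (EuclideanSpace ℝ (Fin d))) :
    Set (ℕ × Set (EuclideanSpace ℝ (Fin d))) :=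
  {P | P.2 ∈ L.cubes P.1 ∧ P.2 ⊆ L.double k Q ∧ L.sideLength P.1 ≤ L.sideLength k}

/-- The sum `∑_{P ⊆ 2Q} (ℓ(P)/ℓ(Q))^γ θ_μ(2 B_P)² μ(P)`. -/
def energyDouble (L : DMLattice μ c C₀ A₀) (n : ℕ) (γ : ℝ) (k : ℕ)
    (Q : Set (EuclideanSpace ℝ (Fin d))) : ℝ≥0∞ :=
  ∑' P : L.cubesInDouble k Q,
    ENNReal.ofReal ((L.sideLength P.1.1 / L.sideLength k) ^ γ) *
      L.twoBallDensity n P.1.1 P.1.2 ^ 2 * μ P.1.2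

end DMLattice

/-- `∫_S (∫_T |x - y|^{-n} dμ(y))² dμ(x)`. -/
def interaction {d : ℕ} (μ : Measure (EuclideanSpace ℝ (Fin d))) (n : ℕ)
    (S T : Set (EuclideanSpace ℝ (Fin d))) : ℝ≥0∞ :=
  ∫⁻ x in S, (∫⁻ y in T, (edist x y ^ n)⁻¹ ∂μ) ^ 2 ∂μ

end

/-! Write `A` for `A₀`, θ_i(x) for the normalized mass of B(x, 28 A^{-i}), and σ_i = θ_i² μ. If x
and y lie on different sides of the boundary of Q, of generation k, and |x - y| ~ A^{-k-l}, then x ∈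
N_l(Q). So the inner integrals are at most a large-scale term plus A^n Σ_l 1_{N_l(Q)} θ_{k+l}, and
Cauchy–Schwarz with geometric weights leaves Σ_l b^l σ_{k+l}(N_l(Q)) to be bounded, with b ≥ 2
(`interaction_le`).

Small boundaries for μ give no direct control of the measures σ_i. The lattice is therefore built
with small boundaries also for ν_k = Σ_l a^l σ_{k+l}, a = A^{-γ}. The densities are centered at
points, not at cubes, so ν_k is known before the lattice is chosen; the lattice depends on n and γ.
The cubes of generation ≥ k meeting 90B(Q) lie in 2Q, so ν_k(90B(Q)) is bounded by the energy of 2Q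
(`tailMeasure_bigBall_le`).

The children of Q meeting N_1(Q) carry a proportion c C₀^{3d+1}/A of ν_k (`sum_bigBall_le`), and
N_{l+1}(Q) is covered by their layers N_l. Passing from ν_k to ν_{k+1} costs 1/a = A^γ and the
weight costs b. As γ < 1, the gain wins once A exceeds a large multiple of a large power of C₀, and
the estimate iterates over generations (`sum_scaleMeasure_layer_le`). The same iteration for μ gives
the small boundary condition (`measure_layer_le`).

For the construction, each generation has a net of doubling or minimal balls, cut by spheres whose
radii are selected by pigeonhole for both measures at once (`exists_cut`). The position of its
center determines the parent of a child, and a König argument assigns to each point of the support a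
coherent chain of cubes. -/

/-! ### Packing and pigeonhole for radii. -/

theorem EuclideanSpace.card_le_of_separated {d : ℕ} {ι : Type*} (T : Finset ι)
    (z : ι → EuclideanSpace ℝ (Fin d)) (x : EuclideanSpace ℝ (Fin d)) {R δ : ℝ} (hδ : 0 < δ)
    (hR : 0 ≤ R) (hz : ∀ i ∈ T, dist (z i) x ≤ R)
    (hsep : ∀ i ∈ T, ∀ j ∈ T, i ≠ j → δ ≤ dist (z i) (z j)) :
    (T.card : ℝ) ≤ (1 + 2 * R / δ) ^ d := by
  have hδ2 : 0 < δ / 2 := by linarith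
  have hρ : 0 < R + δ / 2 := by linarith
  set ν : Measure (EuclideanSpace ℝ (Fin d)) := volume
  have D : Set.PairwiseDisjoint (T : Set ι) (fun i => ball (z i) (δ / 2)) := by
    intro i hi j hj hij
    apply ball_disjoint_ball
    linarith [hsep i hi j hj hij]
  have hsub : (⋃ i ∈ T, ball (z i) (δ / 2)) ⊆ ball x (R + δ / 2) := by
    refine iUnion₂_subset fun i hi => ball_subset_ball' ?_
    linarith [hz i hi]
  have I : (T.card : ℝ≥0∞) * ENNReal.ofReal ((δ / 2) ^ d) * ν (ball 0 1) ≤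
      ENNReal.ofReal ((R + δ / 2) ^ d) * ν (ball 0 1) := by
    calc _ = ν (⋃ i ∈ T, ball (z i) (δ / 2)) := by
          rw [measure_biUnion_finset D fun c _ => measurableSet_ball]
          simp only [ν, Measure.addHaar_ball_of_pos _ _ hδ2, finrank_euclideanSpace,
            Fintype.card_fin, Finset.sum_const, nsmul_eq_mul, mul_assoc]
      _ ≤ ν (ball x (R + δ / 2)) := measure_mono hsub
      _ = _ := by
          simp only [ν, Measure.addHaar_ball_of_pos _ _ hρ, finrank_euclideanSpace,
            Fintype.card_fin]
  have J : (T.card : ℝ≥0∞) * ENNReal.ofReal ((δ / 2) ^ d) ≤ ENNReal.ofReal ((R + δ / 2) ^ d) :=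
    (ENNReal.mul_le_mul_iff_left (measure_ball_pos _ _ zero_lt_one).ne'
      measure_ball_lt_top.ne).1 I
  have K := ENNReal.toReal_le_of_le_ofReal (pow_nonneg hρ.le _) J
  rw [ENNReal.toReal_mul, ENNReal.toReal_natCast,
    ENNReal.toReal_ofReal (pow_nonneg hδ2.le _)] at K
  have hpos : 0 < (δ / 2) ^ d := pow_pos hδ2 d
  have h1 : (1 + 2 * R / δ) ^ d * (δ / 2) ^ d = (R + δ / 2) ^ d := by
    rw [← mul_pow]; congr 1; field_simp; ring
  rw [← h1] at K
  exact le_of_mul_le_mul_right K hpos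

/-- Among the spheres with center `x` and radius in `[p, p + s]` there is one whose neighborhood of
width `w` carries a small proportion of each of the sets `G q`, for finitely many measures. -/
theorem exists_radius_measure_annulus_le {X ι : Type*} [PseudoMetricSpace X] [MeasurableSpace X]
    [OpensMeasurableSpace X] (F : Finset ι) (ν : ι → Measure X) (G : ι → Set X) (x : X)
    {p s w : ℝ} (hw : 0 < w) {M : ℕ} (hM : 0 < M) (hs : 3 * w * M ≤ s) :
    ∃ ρ, p ≤ ρ ∧ ρ ≤ p + s ∧ ∀ q ∈ F,
      ν q (G q ∩ {y | |dist y x - ρ| ≤ w}) ≤ (F.card / M : ℝ≥0∞) * ν q (G q) := by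
  have hM0 : (M : ℝ≥0∞) ≠ 0 := by exact_mod_cast hM.ne'
  -- Spacing `3 * w` makes the annuli of half-width `w` disjoint, and `M` of them fit since `3 * w *
  -- M ≤ s`.
  let An : ℕ → Set X := fun m => {y | |dist y x - (p + 3 * w * m)| ≤ w}
  have hAn : ∀ m, MeasurableSet (An m) := fun m =>
    measurableSet_le (by fun_prop) measurable_const
  have hdis : ∀ m m', m < m' → Disjoint (An m) (An m') := by
    intro m m' h
    rw [Set.disjoint_left]
    intro y hy hy'
    have h1 := abs_le.1 (show |dist y x - (p + 3 * w * m)| ≤ w from hy)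
    have h2 := abs_le.1 (show |dist y x - (p + 3 * w * m')| ≤ w from hy')
    have h3 : (m : ℝ) + 1 ≤ m' := by exact_mod_cast h
    nlinarith
  have hdis' : Set.PairwiseDisjoint (Finset.range M : Set ℕ) An := by
    intro m _ m' _ h
    rcases lt_or_gt_of_ne h with h | h
    · exact hdis _ _ h
    · exact (hdis _ _ h).symm
  have hsum : ∀ q, ∑ m ∈ Finset.range M, ν q (G q ∩ An m) / ν q (G q) ≤ 1 := by
    intro q
    simp only [div_eq_mul_inv]
    rw [← Finset.sum_mul, ← div_eq_mul_inv]
    refine ENNReal.div_le_of_le_mul ?_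
    rw [one_mul]
    calc ∑ m ∈ Finset.range M, ν q (G q ∩ An m)
        = ∑ m ∈ Finset.range M, (ν q).restrict (G q) (An m) := by
          refine Finset.sum_congr rfl fun m _ => ?_
          rw [Measure.restrict_apply (hAn m), inter_comm]
      _ = (ν q).restrict (G q) (⋃ m ∈ Finset.range M, An m) :=
          (measure_biUnion_finset hdis' fun m _ => hAn m).symm
      _ ≤ (ν q).restrict (G q) univ := measure_mono (subset_univ _)
      _ = ν q (G q) := by simp
  -- The relative masses add up to at most `F.card`, so one of the `M` annuli gets at most the
  -- average, simultaneously for all `q`.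
  have htot : ∑ m ∈ Finset.range M, ∑ q ∈ F, ν q (G q ∩ An m) / ν q (G q) ≤
      ∑ m ∈ Finset.range M, (F.card / M : ℝ≥0∞) := by
    rw [Finset.sum_comm]
    calc _ ≤ ∑ q ∈ F, (1 : ℝ≥0∞) := Finset.sum_le_sum fun q _ => hsum q
      _ = _ := by
        simp only [Finset.sum_const, nsmul_eq_mul, mul_one, Finset.card_range]
        rw [ENNReal.mul_div_cancel hM0 (ENNReal.natCast_ne_top M)]
  obtain ⟨m, hm, hle⟩ : ∃ m ∈ Finset.range M,
      ∑ q ∈ F, ν q (G q ∩ An m) / ν q (G q) ≤ (F.card / M : ℝ≥0∞) := by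
    by_contra! h
    exact htot.not_gt (ENNReal.sum_lt_sum_of_nonempty (Finset.nonempty_range_iff.2 hM.ne') h)
  have hmM : (m : ℝ) ≤ M := by exact_mod_cast (Finset.mem_range.1 hm).le
  have hm0 : (0 : ℝ) ≤ m := Nat.cast_nonneg m
  refine ⟨p + 3 * w * m, by nlinarith [mul_nonneg hw.le hm0],
    by nlinarith [mul_le_mul_of_nonneg_left hmM hw.le], fun q hq => ?_⟩
  have hq' : ν q (G q ∩ An m) / ν q (G q) ≤ (F.card / M : ℝ≥0∞) :=
    (Finset.single_le_sum (f := fun q => ν q (G q ∩ An m) / ν q (G q)) (fun _ _ => zero_le)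
      hq).trans hle
  rcases eq_or_ne (ν q (G q)) 0 with h0 | h0
  · rw [measure_mono_null inter_subset_left h0]; exact zero_le
  rcases eq_or_ne (ν q (G q)) ∞ with h1 | h1
  · rw [h1, ENNReal.mul_top]
    · exact le_top
    · have : F.card ≠ 0 := (Finset.card_pos.2 ⟨q, hq⟩).ne'
      simp [ENNReal.div_eq_zero_iff, this]
  · exact (ENNReal.div_le_iff h0 h1).1 hq'

/-! ### Nets of doubling or minimal balls. -/

/-- Either the ball `B(x, r)` is doubling, or its radius is the smallest admissible one and the
measure grows fast at the larger scales. -/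
def DoublingOrSmall {X : Type*} [PseudoMetricSpace X] [MeasurableSpace X] (μ : Measure X)
    (C₀ s : ℝ) (x : X) (r : ℝ) : Prop :=
  μ (closedBall x (100 * r)) ≤ ENNReal.ofReal C₀ * μ (closedBall x r) ∨
    (r = s ∧ ∀ l : ℕ, 1 ≤ l → (100 : ℝ) ^ l ≤ C₀ →
      μ (closedBall x (100 * r)) ≤
        ENNReal.ofReal ((C₀ ^ l)⁻¹) * μ (closedBall x (100 ^ (l + 1) * r)))

/-- The candidates are the radii 100^l s with 100^l ≤ C₀. If none of them is doubling, each failure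
gains a factor C₀, and chaining the failures gives the growth from the radius s. -/
theorem exists_radius_doublingOrSmall {X : Type*} [PseudoMetricSpace X] [MeasurableSpace X]
    (μ : Measure X) {C₀ s : ℝ} (hC : 1 < C₀) (hs : 0 < s) (x : X) :
    ∃ r, s ≤ r ∧ r ≤ C₀ * s ∧ DoublingOrSmall μ C₀ s x r := by
  by_cases h : ∃ l : ℕ, (100 : ℝ) ^ l ≤ C₀ ∧
      μ (closedBall x (100 * (100 ^ l * s))) ≤ ENNReal.ofReal C₀ * μ (closedBall x (100 ^ l * s))
  · obtain ⟨l, hl, h⟩ := h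
    refine ⟨100 ^ l * s, ?_, by gcongr, Or.inl h⟩
    have : (1 : ℝ) ≤ 100 ^ l := one_le_pow₀ (by norm_num)
    nlinarith
  · push Not at h
    refine ⟨s, le_rfl, by nlinarith, Or.inr ⟨rfl, ?_⟩⟩
    have hC0 : 0 < C₀ := by linarith
    have key : ∀ l : ℕ, (100 : ℝ) ^ l ≤ C₀ →
        μ (closedBall x (100 * s)) ≤
        ENNReal.ofReal ((C₀ ^ l)⁻¹) * μ (closedBall x (100 ^ (l + 1) * s)) := by
      intro l
      induction l with
      | zero => intro _; simp
      | succ l ih =>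
        intro hl
        have hl' : (100 : ℝ) ^ l ≤ C₀ :=
          (pow_le_pow_right₀ (by norm_num) (Nat.le_succ l)).trans hl
        refine (ih hl').trans ?_
        have h1 := (h (l + 1) hl).le
        rw [show (100 : ℝ) * (100 ^ (l + 1) * s) = 100 ^ (l + 1 + 1) * s by ring] at h1
        have h2 : ENNReal.ofReal ((C₀ ^ l)⁻¹) =
            ENNReal.ofReal ((C₀ ^ (l + 1))⁻¹) * ENNReal.ofReal C₀ := by
          rw [← ENNReal.ofReal_mul (by positivity)]
          congr 1
          field_simp
          ring
        rw [h2, mul_assoc]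
        gcongr
    exact fun l _ hl => key l hl

/-- A finite family of balls `B(z i, r i)`, `i < N`, of radius comparable to `s`, adapted to `μ`,
such that the balls `5 B` are disjoint and the balls `20 B` cover the support. -/
structure BallNet {d : ℕ} (μ : Measure (EuclideanSpace ℝ (Fin d))) (C₀ s : ℝ) where
  N : ℕ
  z : ℕ → EuclideanSpace ℝ (Fin d)
  r : ℕ → ℝ
  z_mem : ∀ i < N, z i ∈ μ.support
  le_r : ∀ i < N, s ≤ r i
  r_le : ∀ i < N, r i ≤ C₀ * s
  sep : ∀ i < N, ∀ j < N, i ≠ j → 5 * r i + 5 * r j < dist (z i) (z j)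
  cover : ∀ x ∈ μ.support, ∃ i < N, dist x (z i) ≤ 20 * r i
  doubling : ∀ i < N, DoublingOrSmall μ C₀ s (z i) (r i)

/-- Vitali's covering lemma for the balls 5B with enlargement 4 gives disjoint 5B and covering 20B.
Packing in the bounded support makes the family finite. -/
theorem BallNet.nonempty {d : ℕ} (μ : Measure (EuclideanSpace ℝ (Fin d))) {C₀ s : ℝ}
    (hC : 1 < C₀) (hs : 0 < s) (hμ : IsCompact μ.support) : Nonempty (BallNet μ C₀ s) := by
  choose r hr1 hr2 hr3 using fun x => exists_radius_doublingOrSmall μ hC hs x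
  obtain ⟨u, hu, hdis, hcov⟩ := Vitali.exists_disjoint_subfamily_covering_enlargement_closedBall
    μ.support id (fun x => 5 * r x) (5 * (C₀ * s)) (fun a _ => by linarith [hr2 a]) 4 (by norm_num)
  have hpos : ∀ x, 0 < r x := fun x => hs.trans_le (hr1 x)
  have hsep : ∀ x ∈ u, ∀ y ∈ u, x ≠ y → 5 * r x + 5 * r y < dist x y := fun x hx y hy hxy =>
    (disjoint_closedBall_closedBall_iff (by linarith [hpos x]) (by linarith [hpos y])).1
      (hdis hx hy hxy)
  obtain ⟨R, hR0, hR⟩ := hμ.isBounded.subset_closedBall_lt 0 0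
  have hfin : u.Finite := by
    by_contra hinf
    obtain ⟨m, hm⟩ := exists_nat_gt ((1 + 2 * R / s) ^ d)
    obtain ⟨T, hT, hTc⟩ := Set.Infinite.exists_subset_card_eq hinf m
    have := EuclideanSpace.card_le_of_separated T id 0 hs hR0.le
      (fun i hi => hR (hu (hT hi))) (fun i hi j hj hij => by
        have := hsep i (hT hi) j (hT hj) hij
        have := hr1 i
        have := hpos j
        simp only [id]
        linarith)
    rw [hTc] at this
    linarith
  set T := hfin.toFinset
  let e := T.equivFin
  let z : ℕ → EuclideanSpace ℝ (Fin d) := fun i => if h : i < T.card then (e.symm ⟨i, h⟩).1 else 0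
  have hz : ∀ i (h : i < T.card), z i = (e.symm ⟨i, h⟩).1 := fun i h => dif_pos h
  have hzu : ∀ i < T.card, z i ∈ u := fun i h => by
    rw [hz i h]; exact hfin.mem_toFinset.1 (e.symm ⟨i, h⟩).2
  have hinj : ∀ i < T.card, ∀ j < T.card, i ≠ j → z i ≠ z j := by
    intro i hi j hj hij h
    rw [hz i hi, hz j hj] at h
    exact hij (by simpa using e.symm.injective (Subtype.ext h))
  refine ⟨⟨T.card, z, fun i => r (z i), fun i hi => hu (hzu i hi), fun i _ => hr1 _,
    fun i _ => hr2 _, fun i hi j hj hij => hsep _ (hzu i hi) _ (hzu j hj) (hinj i hi j hj hij),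
    fun x hx => ?_, fun i _ => hr3 _⟩⟩
  obtain ⟨b, hb, hsub⟩ := hcov x hx
  have hbT : b ∈ T := hfin.mem_toFinset.2 hb
  refine ⟨e ⟨b, hbT⟩, (e ⟨b, hbT⟩).2, ?_⟩
  have hzb : z (e ⟨b, hbT⟩) = b := by
    rw [hz _ (e ⟨b, hbT⟩).2]; simp
  have hx' := hsub (mem_closedBall_self (by linarith [hpos x]) : x ∈ closedBall x (5 * r x))
  rw [hzb]
  have : dist x b ≤ 4 * (5 * r b) := hx'
  linarith

/-! ### Coherent measurable choice of ancestors. -/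

theorem measurable_nat_sInf {X : Type*} [MeasurableSpace X] {p : X → ℕ → Prop}
    (hp : ∀ k, MeasurableSet {x | p x k}) : Measurable fun x => sInf {k | p x k} := by
  classical
  -- `Nat.find` needs a witness: the second alternative makes it return 0 when `p x` is empty, in
  -- agreement with `sInf ∅ = 0`.
  have h : ∀ x, ∃ k, p x k ∨ ∀ j, ¬ p x j := fun x => by
    by_cases hx : ∃ k, p x k
    · exact hx.imp fun k hk => Or.inl hk
    · exact ⟨0, Or.inr (not_exists.1 hx)⟩
  have h0 : MeasurableSet {x | ∀ j, ¬ p x j} := by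
    have h1 : {x | ∀ j, ¬ p x j} = ⋂ j, {x | p x j}ᶜ := by ext x; simp
    rw [h1]
    exact MeasurableSet.iInter fun j => (hp j).compl
  have hm : ∀ k, MeasurableSet {x | p x k ∨ ∀ j, ¬ p x j} := fun k =>
    (hp k).union h0
  convert measurable_find h hm using 1
  funext x
  by_cases hx : ∃ k, p x k
  · rw [Nat.sInf_def (show {k | p x k}.Nonempty from hx)]
    refine le_antisymm (Nat.find_mono fun k hk => ?_) (Nat.find_mono fun k hk => Or.inl hk)
    exact hk.resolve_right fun h => hx.elim h
  · have h0 : {k | p x k} = ∅ := by ext k; simpa using not_exists.1 hx k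
    rw [h0, Nat.sInf_empty, eq_comm, Nat.find_eq_zero]
    exact Or.inr (not_exists.1 hx)

section Tree

variable {X : Type*} (ι : ℕ → X → ℕ) (z : ℕ → ℕ → X)

/-- The index of the ancestor, in generation `k`, of the piece of generation `k + m`
containing `x`. -/
def treeAncestor : ℕ → ℕ → X → ℕ
  | k, 0, x => ι k x
  | k, m + 1, x => ι k (z (k + 1) (treeAncestor (k + 1) m x))

/-- The lexicographically least cluster point of the sequences of ancestors of `x`. -/
noncomputable def treeIndex : ℕ → X → ℕ
  | 0, x => sInf {i | ∃ᶠ m in Filter.atTop, treeAncestor ι z 0 m x = i}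
  | k + 1, x => sInf {i | ι k (z (k + 1) i) = treeIndex k x ∧
      ∃ᶠ m in Filter.atTop, treeAncestor ι z (k + 1) m x = i}

variable {ι z}

theorem measurable_treeAncestor [MeasurableSpace X] (hι : ∀ k, Measurable (ι k)) (m : ℕ) :
    ∀ k, Measurable (treeAncestor ι z k m) := by
  induction m with
  | zero => exact hι
  | succ m ih =>
    intro k
    exact (measurable_of_countable fun i => ι k (z (k + 1) i)).comp (ih (k + 1))

theorem measurable_treeIndex [MeasurableSpace X] (hι : ∀ k, Measurable (ι k)) (k : ℕ) :
    Measurable (treeIndex ι z k) := by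
  have hS : ∀ k i, MeasurableSet {x | ∃ᶠ m in Filter.atTop, treeAncestor ι z k m x = i} := by
    intro k i
    simp only [Filter.frequently_atTop, ofPred_forall, ofPred_exists]
    refine MeasurableSet.iInter fun a => MeasurableSet.iUnion fun b => ?_
    exact (MeasurableSet.const _).inter (measurable_treeAncestor hι b k (measurableSet_singleton i))
  induction k with
  | zero => exact measurable_nat_sInf (hS 0)
  | succ k ih =>
    refine measurable_nat_sInf fun i => MeasurableSet.inter ?_ (hS (k + 1) i)
    exact measurableSet_eq_fun measurable_const ih

variable {E : Set X} {N : ℕ → ℕ}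

theorem treeAncestor_lt (hι : ∀ k, ∀ x ∈ E, ι k x < N k) (hz : ∀ k, ∀ i < N k, z k i ∈ E)
    {x : X} (hx : x ∈ E) (m : ℕ) : ∀ k, treeAncestor ι z k m x < N k := by
  induction m with
  | zero => exact fun k => hι k x hx
  | succ m ih => exact fun k => hι k _ (hz _ _ (ih (k + 1)))

/-- König's lemma: each generation has finitely many indices, so along the infinitely many `m`
realizing the chosen index in generation `k`, some index of generation `k + 1` recurs. Hence the
infima in `treeIndex` are over nonempty sets and are attained. -/
theorem frequently_treeAncestor_treeIndex (hι : ∀ k, ∀ x ∈ E, ι k x < N k)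
    (hz : ∀ k, ∀ i < N k, z k i ∈ E) {x : X} (hx : x ∈ E) (k : ℕ) :
    (∃ᶠ m in Filter.atTop, treeAncestor ι z k m x = treeIndex ι z k x) ∧
      ι k (z (k + 1) (treeIndex ι z (k + 1) x)) = treeIndex ι z k x := by
  have pigeon : ∀ (k : ℕ) (P : ℕ → Prop), (∃ᶠ m in Filter.atTop, P m) →
      ∃ i, ∃ᶠ m in Filter.atTop, P m ∧ treeAncestor ι z k m x = i := by
    intro k P hP
    by_contra! h
    have h1 : ∀ᶠ m in Filter.atTop, ∀ i ∈ Finset.range (N k),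
        ¬ (P m ∧ treeAncestor ι z k m x = i) :=
      (Filter.eventually_all_finset _).2 fun i _ => (h i).mono fun m hm hP => hm hP.1 hP.2
    refine hP (h1.mono fun m hm hPm => ?_)
    exact hm _ (Finset.mem_range.2 (treeAncestor_lt hι hz hx m k)) ⟨hPm, rfl⟩
  have step : ∀ k, (∃ᶠ m in Filter.atTop, treeAncestor ι z k m x = treeIndex ι z k x) →
      ι k (z (k + 1) (treeIndex ι z (k + 1) x)) = treeIndex ι z k x ∧
      ∃ᶠ m in Filter.atTop, treeAncestor ι z (k + 1) m x = treeIndex ι z (k + 1) x := by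
    intro k h
    have h1 : ∃ᶠ m in Filter.atTop, treeAncestor ι z k (m + 1) x = treeIndex ι z k x := by
      rw [Filter.frequently_atTop] at h ⊢
      intro a
      obtain ⟨b, hb, h⟩ := h (a + 1)
      exact ⟨b - 1, by omega, by rwa [Nat.sub_add_cancel (by omega)]⟩
    obtain ⟨i, hi⟩ := pigeon (k + 1) _ h1
    have hmem : i ∈ {i | ι k (z (k + 1) i) = treeIndex ι z k x ∧
        ∃ᶠ m in Filter.atTop, treeAncestor ι z (k + 1) m x = i} := by
      refine ⟨?_, hi.mono fun m h => h.2⟩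
      obtain ⟨m, h2, h3⟩ := hi.exists
      rw [← h3]; exact h2
    exact Nat.sInf_mem ⟨i, hmem⟩
  have main : ∀ k, ∃ᶠ m in Filter.atTop, treeAncestor ι z k m x = treeIndex ι z k x := by
    intro k
    induction k with
    | zero =>
      obtain ⟨i, hi⟩ := pigeon 0 (fun _ => True) (Filter.Eventually.frequently (by simp))
      exact Nat.sInf_mem (s := {i | ∃ᶠ m in Filter.atTop, treeAncestor ι z 0 m x = i})
        ⟨i, hi.mono fun m h => h.2⟩
    | succ k ih => exact (step k ih).2
  exact ⟨main k, (step k (main k)).1⟩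

/-- The displacements decay geometrically: D A^{-k} + 2D A^{-k-1} ≤ 2D A^{-k} because A ≥ 2. -/
theorem dist_treeAncestor_le [PseudoMetricSpace X] (hι : ∀ k, ∀ x ∈ E, ι k x < N k)
    (hz : ∀ k, ∀ i < N k, z k i ∈ E) {A D : ℝ} (hA : 2 ≤ A) (hD : 0 ≤ D)
    (hdist : ∀ k, ∀ x ∈ E, dist x (z k (ι k x)) ≤ D * (A ^ k)⁻¹) {x : X} (hx : x ∈ E) (m : ℕ) :
    ∀ k, dist x (z k (treeAncestor ι z k m x)) ≤ 2 * D * (A ^ k)⁻¹ := by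
  have hA0 : 0 < A := by linarith
  induction m with
  | zero =>
    intro k
    have : 0 ≤ D * (A ^ k)⁻¹ := by positivity
    refine (hdist k x hx).trans (by linarith)
  | succ m ih =>
    intro k
    have h1 := ih (k + 1)
    have h2 := hdist k _ (hz _ _ (treeAncestor_lt hι hz hx m (k + 1)))
    have h3 := dist_triangle x (z (k + 1) (treeAncestor ι z (k + 1) m x))
      (z k (treeAncestor ι z k (m + 1) x))
    have h4 : 2 * (A ^ (k + 1))⁻¹ ≤ (A ^ k)⁻¹ := by
      rw [pow_succ, mul_inv]
      have : A⁻¹ ≤ 2⁻¹ := inv_anti₀ (by norm_num) hA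
      have h5 : 0 ≤ (A ^ k)⁻¹ := by positivity
      nlinarith
    have h6 := mul_le_mul_of_nonneg_left h4 hD
    change _ ≤ _ at h2
    simp only [treeAncestor] at *
    linarith

end Tree

/-! ### The pieces of one generation and their boundary shells. -/

theorem sum_measure_le_of_card_le {X ι : Type*} [MeasurableSpace X] (ν : Measure X)
    (J : Finset ι) (S : ι → Set X) (U : Set X) (m : ℝ≥0∞) (hS : ∀ j ∈ J, MeasurableSet (S j))
    (hU : ∀ j ∈ J, S j ⊆ U) (hm : ∀ x, ∀ T ⊆ J, (∀ j ∈ T, x ∈ S j) → (T.card : ℝ≥0∞) ≤ m) :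
    ∑ j ∈ J, ν (S j) ≤ m * ν U := by
  classical
  calc ∑ j ∈ J, ν (S j) = ∑ j ∈ J, ∫⁻ x in U, (S j).indicator 1 x ∂ν := by
        refine Finset.sum_congr rfl fun j hj => ?_
        rw [lintegral_indicator_one (hS j hj), Measure.restrict_apply (hS j hj),
          inter_eq_left.2 (hU j hj)]
    _ = ∫⁻ x in U, ∑ j ∈ J, (S j).indicator 1 x ∂ν :=
        (lintegral_finsetSum' _ fun j hj => (measurable_one.indicator (hS j hj)).aemeasurable).symm
    _ ≤ ∫⁻ _ in U, m ∂ν := by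
        refine lintegral_mono fun x => ?_
        have h := hm x (J.filter fun j => x ∈ S j) (Finset.filter_subset _ _)
          fun j hj => (Finset.mem_filter.1 hj).2
        refine le_trans (le_of_eq ?_) h
        rw [Finset.card_filter]
        push_cast
        exact Finset.sum_congr rfl fun j _ => by simp [indicator_apply]
    _ = m * ν U := by simp

theorem abs_dist_sub_le_of_not_iff {X : Type*} [PseudoMetricSpace X] {u v z : X} {ρ : ℝ}
    (h : ¬ (dist u z ≤ ρ ↔ dist v z ≤ ρ)) : |dist u z - ρ| ≤ dist u v := by
  have h1 := dist_triangle u v z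
  have h2 := dist_triangle v u z
  rw [dist_comm v u] at h2
  rw [abs_le]
  by_cases hu : dist u z ≤ ρ
  · have hv : ρ < dist v z := not_le.1 fun hv => h ⟨fun _ => hv, fun _ => hu⟩
    constructor <;> linarith [dist_nonneg (x := u) (y := v)]
  · have hv : dist v z ≤ ρ := by
      by_contra hv
      exact h ⟨fun h' => absurd h' hu, fun h' => absurd h' hv⟩
    have hu := not_le.1 hu
    constructor <;> linarith [dist_nonneg (x := u) (y := v)]

namespace BallNet

variable {d : ℕ} {μ : Measure (EuclideanSpace ℝ (Fin d))} {C₀ s : ℝ}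

/-- The indices of the balls of the net whose center is close to that of `B(z i, r i)`. -/
noncomputable def near (B : BallNet μ C₀ s) (i : ℕ) : Finset ℕ :=
  (Finset.range B.N).filter fun j => dist (B.z j) (B.z i) ≤ 45 * C₀ * s

theorem mem_near {B : BallNet μ C₀ s} {i j : ℕ} :
    j ∈ B.near i ↔ j < B.N ∧ dist (B.z j) (B.z i) ≤ 45 * C₀ * s := by
  simp [near]

theorem card_le (B : BallNet μ C₀ s) (hs : 0 < s) {x : EuclideanSpace ℝ (Fin d)}
    (T : Finset ℕ) (hT : ∀ j ∈ T, j < B.N) {R : ℝ} (hR : 0 ≤ R)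
    (h : ∀ j ∈ T, dist (B.z j) x ≤ R * s) : (T.card : ℝ) ≤ (1 + R / 5) ^ d := by
  have := EuclideanSpace.card_le_of_separated T B.z x (R := R * s) (δ := 10 * s) (by positivity)
    (by positivity) h (fun i hi j hj hij => by
      have := B.sep i (hT i hi) j (hT j hj) hij
      linarith [B.le_r i (hT i hi), B.le_r j (hT j hj)])
  convert this using 3
  field_simp
  ring

theorem card_near_le (B : BallNet μ C₀ s) (hs : 0 < s) (hC : 1 < C₀) (i : ℕ) :
    ((B.near i).card : ℝ) ≤ (10 * C₀) ^ d := by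
  refine (B.card_le hs (x := B.z i) (B.near i) (fun j hj => (mem_near.1 hj).1) (R := 45 * C₀)
    (by linarith) fun j hj => (mem_near.1 hj).2).trans ?_
  gcongr
  linarith

/-- The spherical shell of width `200 C₀ s / A` around the sphere of center `z j` and radius
`ρ`. -/
def shell (B : BallNet μ C₀ s) (A : ℝ) (j : ℕ) (ρ : ℝ) : Set (EuclideanSpace ℝ (Fin d)) :=
  {y | |dist y (B.z j) - ρ| ≤ 200 * C₀ * s / A}

/-- The ball `90 B` of the net. -/
def bigBall (B : BallNet μ C₀ s) (i : ℕ) : Set (EuclideanSpace ℝ (Fin d)) :=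
  closedBall (B.z i) (90 * B.r i)

/-- Pigeonhole over the pairs `(i, q)`, at most 2(10C₀)^d of them, against about A/(600C₀) disjoint
shells. The index `q` makes one sphere good for two measures. -/
theorem exists_cut (B : BallNet μ C₀ s) (hs : 0 < s) (hC : 1 < C₀) {A : ℝ} (hA : 5000 * C₀ < A)
    (ν : Bool → Measure (EuclideanSpace ℝ (Fin d))) (j : ℕ) (p : ℝ) :
    ∃ ρ, p ≤ ρ ∧ ρ ≤ p + s ∧ ∀ i ∈ B.near j, ∀ q,
      ν q (B.bigBall i ∩ B.shell A j ρ) ≤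
        ENNReal.ofReal (2400 * 10 ^ d * C₀ ^ (d + 1) / A) * ν q (B.bigBall i) := by
  have hC0 : 0 < C₀ := by linarith
  have hA0 : 0 < A := by linarith
  have h8 : 8 ≤ A / (600 * C₀) := by rw [le_div_iff₀ (by positivity)]; linarith
  set M := ⌊A / (600 * C₀)⌋₊
  have hM1 : (M : ℝ) ≤ A / (600 * C₀) := Nat.floor_le (by positivity)
  have hM2 : A / (1200 * C₀) ≤ M := by
    have h1 : A / (600 * C₀) < M + 1 := Nat.lt_floor_add_one _
    have h2 : A / (600 * C₀) = 2 * (A / (1200 * C₀)) := by field_simp; norm_num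
    linarith
  have hMpos : (0 : ℝ) < M := lt_of_lt_of_le (by positivity) hM2
  obtain ⟨ρ, h1, h2, h3⟩ := exists_radius_measure_annulus_le
    (B.near j ×ˢ (Finset.univ : Finset Bool))
    (fun t => ν t.2) (fun t => B.bigBall t.1) (B.z j) (p := p) (s := s) (w := 200 * C₀ * s / A)
    (by positivity) (M := M) (by exact_mod_cast hMpos) (by
      calc 3 * (200 * C₀ * s / A) * M ≤ 3 * (200 * C₀ * s / A) * (A / (600 * C₀)) := by gcongr
        _ = s := by field_simp; norm_num)
  refine ⟨ρ, h1, h2, fun i hi q => (h3 (i, q) (by simp [hi])).trans ?_⟩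
  gcongr
  rw [Finset.card_product, Finset.card_univ, Fintype.card_bool,
    ← ENNReal.ofReal_natCast, ← ENNReal.ofReal_natCast, ← ENNReal.ofReal_div_of_pos hMpos]
  refine ENNReal.ofReal_le_ofReal ?_
  push_cast
  calc ((B.near j).card * 2 : ℝ) / M ≤ ((10 * C₀) ^ d * 2) / (A / (1200 * C₀)) := by
        gcongr
        exact B.card_near_le hs hC j
    _ = _ := by field_simp; ring

/-- The index of the piece containing `x` in the partition defined by the inner radii `a` and the
outer radii `b`. -/
noncomputable def index (B : BallNet μ C₀ s) (a b : ℕ → ℝ) (x : EuclideanSpace ℝ (Fin d)) : ℕ :=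
  sInf {j | j < B.N ∧ (dist x (B.z j) ≤ a j ∨
    (∀ i < B.N, ¬ dist x (B.z i) ≤ a i) ∧ dist x (B.z j) ≤ b j)}

theorem measurable_index (B : BallNet μ C₀ s) (a b : ℕ → ℝ) : Measurable (B.index a b) := by
  refine measurable_nat_sInf fun j => (MeasurableSet.const _).inter ?_
  have h : ∀ (j : ℕ) (a : ℕ → ℝ), MeasurableSet {x | dist x (B.z j) ≤ a j} := fun j a =>
    measurableSet_le (by fun_prop) measurable_const
  have h1 : {x | ∀ i < B.N, ¬ dist x (B.z i) ≤ a i} =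
      ⋂ i, ⋂ (_ : i < B.N), {x | dist x (B.z i) ≤ a i}ᶜ := by ext x; simp
  have h2 : MeasurableSet {x | ∀ i < B.N, ¬ dist x (B.z i) ≤ a i} := by
    rw [h1]
    exact MeasurableSet.iInter fun i => MeasurableSet.iInter fun _ => (h i a).compl
  exact (h j a).union (h2.inter (h j b))

variable {B : BallNet μ C₀ s} {a b : ℕ → ℝ}

theorem index_spec (hb : ∀ j < B.N, 20 * B.r j ≤ b j) (hab : ∀ j < B.N, a j ≤ b j)
    {x : EuclideanSpace ℝ (Fin d)} (hx : x ∈ μ.support) :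
    B.index a b x < B.N ∧ dist x (B.z (B.index a b x)) ≤ b (B.index a b x) := by
  have hne : {j | j < B.N ∧ (dist x (B.z j) ≤ a j ∨
    (∀ i < B.N, ¬ dist x (B.z i) ≤ a i) ∧ dist x (B.z j) ≤ b j)}.Nonempty := by
    by_cases h : ∃ i < B.N, dist x (B.z i) ≤ a i
    · obtain ⟨i, hi, h⟩ := h
      exact ⟨i, hi, Or.inl h⟩
    · obtain ⟨i, hi, h'⟩ := B.cover x hx
      push Not at h
      exact ⟨i, hi, Or.inr ⟨fun j hj => not_le.2 (h j hj), h'.trans (hb i hi)⟩⟩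
  obtain ⟨h1, h2⟩ := Nat.sInf_mem hne
  exact ⟨h1, h2.elim (fun h => h.trans (hab _ h1)) fun h => h.2⟩

/-- Inner balls take precedence over outer ones, and at most one contains `x` since the balls 5B are
disjoint. -/
theorem index_eq (ha : ∀ j < B.N, a j ≤ 5 * B.r j) {x : EuclideanSpace ℝ (Fin d)} {i : ℕ}
    (hi : i < B.N) (hx : dist x (B.z i) ≤ a i) : B.index a b x = i := by
  have h : {j | j < B.N ∧ (dist x (B.z j) ≤ a j ∨
      (∀ i < B.N, ¬ dist x (B.z i) ≤ a i) ∧ dist x (B.z j) ≤ b j)} = {i} := by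
    ext j
    simp only [mem_ofPred_eq, mem_singleton_iff]
    constructor
    · rintro ⟨hj, h | h⟩
      · by_contra hne
        have h1 := B.sep j hj i hi hne
        have h2 := dist_triangle_left (B.z j) (B.z i) x
        linarith [ha i hi, ha j hj]
      · exact absurd hx (h.1 i hi)
    · rintro rfl
      exact ⟨hi, Or.inl hx⟩
  rw [index, h, csInf_singleton]

/-- The index depends only on which inner and outer balls contain the point, so some sphere
separates `u` from `v`. -/
theorem exists_shell_of_index_ne {u v : EuclideanSpace ℝ (Fin d)}
    (h : B.index a b u ≠ B.index a b v) :
    ∃ j < B.N, ∃ ρ, (ρ = a j ∨ ρ = b j) ∧ |dist u (B.z j) - ρ| ≤ dist u v ∧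
      |dist v (B.z j) - ρ| ≤ dist u v := by
  by_contra! hc
  have key : ∀ j < B.N, ∀ ρ, (ρ = a j ∨ ρ = b j) →
      (dist u (B.z j) ≤ ρ ↔ dist v (B.z j) ≤ ρ) := by
    intro j hj ρ hρ
    by_contra hne
    have h1 := abs_dist_sub_le_of_not_iff hne
    have h2 := abs_dist_sub_le_of_not_iff fun h => hne h.symm
    rw [dist_comm v u] at h2
    exact absurd h2 (not_le.2 (hc j hj ρ hρ h1))
  refine h ?_
  unfold index
  congr 1
  ext j
  simp only [mem_ofPred_eq]
  refine and_congr_right fun hj => or_congr (key j hj _ (Or.inl rfl))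
    (and_congr (forall₂_congr fun i hi => not_congr (key i hi _ (Or.inl rfl)))
      (key j hj _ (Or.inr rfl)))

/-- The large balls of the children in question lie in few thin shells and overlap boundedly. The
three factors C₀^d come from this overlap, from the number of nearby spheres and from the pigeonhole
in `exists_cut`; the last C₀ comes from the width of the shells. -/
theorem sum_bigBall_le (hs : 0 < s) (hC : 1 < C₀) {A : ℝ} (hA : 5000 * C₀ < A)
    {s' : ℝ} (hs' : s' = s / A) (B' : BallNet μ C₀ s')
    (ν : Bool → Measure (EuclideanSpace ℝ (Fin d)))
    (ha : ∀ j < B.N, a j ≤ 5 * B.r j) (hb : ∀ j < B.N, b j ≤ 21 * B.r j)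
    (hcut : ∀ j < B.N, ∀ ρ, (ρ = a j ∨ ρ = b j) → ∀ i ∈ B.near j, ∀ q,
      ν q (B.bigBall i ∩ B.shell A j ρ) ≤
        ENNReal.ofReal (2400 * 10 ^ d * C₀ ^ (d + 1) / A) * ν q (B.bigBall i))
    {i : ℕ} (hi : i < B.N) (J : Finset ℕ) (hJ : ∀ l ∈ J, l < B'.N ∧
      ∃ u v, dist u v ≤ 85 * C₀ * s / A ∧ (u = B'.z l ∨ v = B'.z l) ∧
        dist u (B.z i) ≤ 21 * B.r i ∧ B.index a b u ≠ B.index a b v) (q : Bool) :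
    ∑ l ∈ J, ν q (B'.bigBall l) ≤
      ENNReal.ofReal (4800 * 1900 ^ d * C₀ ^ (3 * d + 1) / A) * ν q (B.bigBall i) := by
  subst hs'
  have hC0 : 0 < C₀ := by linarith
  have hA0 : 0 < A := by linarith
  have hsA : 0 < s / A := by positivity
  have hsA' : 5000 * (C₀ * (s / A)) ≤ s := by
    have : 5000 * (C₀ * (s / A)) = s * (5000 * C₀ / A) := by ring
    rw [this]
    have : 5000 * C₀ / A ≤ 1 := by rw [div_le_one hA0]; exact hA.le
    nlinarith
  have hσ : 0 < C₀ * (s / A) := by positivity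
  have e85 : 85 * C₀ * s / A = 85 * (C₀ * (s / A)) := by ring
  have hri := B.le_r i hi
  have hri' := B.r_le i hi
  set U : Set (EuclideanSpace ℝ (Fin d)) := ⋃ j ∈ B.near i,
    (B.bigBall i ∩ B.shell A j (a j)) ∪ (B.bigBall i ∩ B.shell A j (b j))
  have hsub : ∀ l ∈ J, B'.bigBall l ⊆ U := by
    intro l hl y hy
    obtain ⟨hl', u, v, huv, hz, hu, hne⟩ := hJ l hl
    obtain ⟨j, hj, ρ, hρ, h1, h2⟩ := exists_shell_of_index_ne hne
    have hrl := B'.r_le l hl'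
    have hy' : dist y (B'.z l) ≤ 90 * B'.r l := hy
    have hy2 : dist y (B'.z l) ≤ 90 * (C₀ * (s / A)) := by linarith
    rw [e85] at huv
    have hzl : |dist (B'.z l) (B.z j) - ρ| ≤ 85 * (C₀ * (s / A)) := by
      rcases hz with h | h
      · rw [← h]; exact h1.trans huv
      · rw [← h]; exact h2.trans huv
    have huz : dist u (B'.z l) ≤ 85 * (C₀ * (s / A)) := by
      rcases hz with h | h
      · rw [h, dist_self]; positivity
      · rw [← h]; exact huv
    have hρ21 : ρ ≤ 21 * B.r j := by
      rcases hρ with h | h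
      · have := ha j hj; have := B.le_r j hj; linarith
      · have := hb j hj; linarith
    have hrj := B.r_le j hj
    have hyi : y ∈ B.bigBall i := by
      have := dist_triangle4 y (B'.z l) u (B.z i)
      rw [dist_comm (B'.z l) u] at this
      change dist y (B.z i) ≤ 90 * B.r i
      linarith
    -- In units of C₀ s/A: 85 from the center of the child to the sphere plus 90 for the radius,
    -- below the width 200.
    have hyj : y ∈ B.shell A j ρ := by
      change |dist y (B.z j) - ρ| ≤ 200 * C₀ * s / A
      have e200 : 200 * C₀ * s / A = 200 * (C₀ * (s / A)) := by ring
      have t1 := dist_triangle y (B'.z l) (B.z j)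
      have t2 := dist_triangle_left (B'.z l) (B.z j) y
      obtain ⟨g1, g2⟩ := abs_le.1 hzl
      rw [e200, abs_le]
      constructor <;> linarith
    have hnear : j ∈ B.near i := by
      refine mem_near.2 ⟨hj, ?_⟩
      have t1 := dist_triangle_left (B.z j) (B.z i) u
      obtain ⟨g1, g2⟩ := abs_le.1 (h1.trans huv)
      nlinarith
    refine mem_iUnion₂.2 ⟨j, hnear, ?_⟩
    rcases hρ with rfl | rfl
    · exact Or.inl ⟨hyi, hyj⟩
    · exact Or.inr ⟨hyi, hyj⟩
  set η := ENNReal.ofReal (2400 * 10 ^ d * C₀ ^ (d + 1) / A)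
  have hUle : ν q U ≤
      ENNReal.ofReal ((10 * C₀) ^ d) * (ENNReal.ofReal 2 * (η * ν q (B.bigBall i))) := by
    calc ν q U ≤ ∑ j ∈ B.near i, ν q ((B.bigBall i ∩ B.shell A j (a j)) ∪
          (B.bigBall i ∩ B.shell A j (b j))) := measure_biUnion_finset_le _ _
      _ ≤ ∑ j ∈ B.near i, ENNReal.ofReal 2 * (η * ν q (B.bigBall i)) := by
          refine Finset.sum_le_sum fun j hj => (measure_union_le _ _).trans ?_
          rw [show ENNReal.ofReal 2 = 2 by simp, two_mul]
          obtain ⟨hj1, hj2⟩ := mem_near.1 hj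
          have hij : i ∈ B.near j := mem_near.2 ⟨hi, by rwa [dist_comm]⟩
          exact add_le_add (hcut j hj1 _ (Or.inl rfl) i hij q) (hcut j hj1 _ (Or.inr rfl) i hij q)
      _ ≤ _ := by
          rw [Finset.sum_const, nsmul_eq_mul, ← ENNReal.ofReal_natCast]
          gcongr
          exact B.card_near_le hs hC i
  calc ∑ l ∈ J, ν q (B'.bigBall l)
      ≤ ENNReal.ofReal ((19 * C₀) ^ d) * ν q U := by
        refine sum_measure_le_of_card_le _ _ _ _ _ (fun _ _ => isClosed_closedBall.measurableSet)
          hsub fun x T hT hx => ?_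
        rw [← ENNReal.ofReal_natCast]
        refine ENNReal.ofReal_le_ofReal ?_
        refine (B'.card_le hsA (x := x) T (fun j hj => (hJ j (hT hj)).1) (R := 90 * C₀)
          (by linarith) fun j hj => ?_).trans ?_
        · have h1 : dist x (B'.z j) ≤ 90 * B'.r j := hx j hj
          rw [dist_comm]
          linarith [B'.r_le j (hJ j (hT hj)).1]
        · gcongr
          linarith
    _ ≤ ENNReal.ofReal ((19 * C₀) ^ d) *
          (ENNReal.ofReal ((10 * C₀) ^ d) * (ENNReal.ofReal 2 * (η * ν q (B.bigBall i)))) := by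
        gcongr
    _ = _ := by
        simp only [η, ← mul_assoc]
        rw [← ENNReal.ofReal_mul (by positivity), ← ENNReal.ofReal_mul (by positivity),
          ← ENNReal.ofReal_mul (by positivity)]
        congr 2
        rw [show (1900 : ℝ) = 19 * 10 * 10 by norm_num]
        simp only [mul_pow]
        ring

end BallNet

/-! ### Nested cubes and iteration of small boundaries. -/

/-- The points of `E \ Q` at distance less than `δ` from `Q`, and the points of `Q` at distance less
than `δ` from `E \ Q`. -/
def boundaryLayer {X : Type*} [PseudoEMetricSpace X] (E Q : Set X) (δ : ℝ) : Set X :=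
  ((E \ Q) ∩ thickening δ Q) ∪ (Q ∩ thickening δ (E \ Q))

theorem mem_boundaryLayer_iff {X : Type*} [PseudoMetricSpace X] {E Q : Set X} {δ : ℝ} {x : X} :
    x ∈ boundaryLayer E Q δ ↔
      (x ∈ E \ Q ∧ ∃ y ∈ Q, dist x y < δ) ∨ (x ∈ Q ∧ ∃ y ∈ E \ Q, dist x y < δ) := by
  simp only [boundaryLayer, mem_union, mem_inter_iff, mem_thickening_iff]

theorem measurableSet_boundaryLayer {X : Type*} [PseudoEMetricSpace X] [MeasurableSpace X]
    [OpensMeasurableSpace X] {E Q : Set X} (hE : MeasurableSet E) (hQ : MeasurableSet Q) (δ : ℝ) :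
    MeasurableSet (boundaryLayer E Q δ) :=
  ((hE.diff hQ).inter isOpen_thickening.measurableSet).union
    (hQ.inter isOpen_thickening.measurableSet)

/-- Nets in all generations with nested partitions of the support subordinate to them: `φ k x` is
the index of the ball of generation `k` whose cube contains `x`. -/
structure CubeSystem {d : ℕ} (μ : Measure (EuclideanSpace ℝ (Fin d))) (C₀ A : ℝ) where
  net : ∀ k : ℕ, BallNet μ C₀ (A ^ k)⁻¹
  φ : ℕ → EuclideanSpace ℝ (Fin d) → ℕ
  par : ℕ → ℕ → ℕ
  measurable_φ : ∀ k, Measurable (φ k)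
  φ_lt : ∀ k, ∀ x ∈ μ.support, φ k x < (net k).N
  par_φ : ∀ k, ∀ x ∈ μ.support, par k (φ (k + 1) x) = φ k x
  φ_eq : ∀ k, ∀ x ∈ μ.support, ∀ i < (net k).N, dist x ((net k).z i) ≤ (net k).r i → φ k x = i
  dist_le : ∀ k, ∀ x ∈ μ.support, dist x ((net k).z (φ k x)) ≤ 28 * (net k).r (φ k x)

namespace CubeSystem

variable {d : ℕ} {μ : Measure (EuclideanSpace ℝ (Fin d))} {C₀ A : ℝ}

/-- The cube of generation `k` and index `i`. -/
def cube (S : CubeSystem μ C₀ A) (k i : ℕ) : Set (EuclideanSpace ℝ (Fin d)) :=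
  {x | x ∈ μ.support ∧ S.φ k x = i}

/-- The layer `N_l(Q)` for the cube `Q` of generation `k` and index `i`. -/
def layer (S : CubeSystem μ C₀ A) (k i l : ℕ) : Set (EuclideanSpace ℝ (Fin d)) :=
  boundaryLayer μ.support (S.cube k i) (A ^ (k + l))⁻¹

open Classical in
/-- The indices of the cubes of generation `k + 1` which meet `N_1(Q)`. -/
noncomputable def boundaryIndices (S : CubeSystem μ C₀ A) (k i : ℕ) : Finset ℕ :=
  (Finset.range (S.net (k + 1)).N).filter fun j => (S.cube (k + 1) j ∩ S.layer k i 1).Nonempty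

/-- The cubes of each generation `k + 1` which are close to the boundary of a cube of
generation `k` carry a small proportion of the measures `ν k q`. -/
def SmallSteps (S : CubeSystem μ C₀ A) (c : ℝ) (ν : ℕ → Bool → Measure (EuclideanSpace ℝ (Fin d))) :
    Prop :=
  ∀ k, ∀ i < (S.net k).N, ∀ q, ∑ j ∈ S.boundaryIndices k i, ν k q ((S.net (k + 1)).bigBall j) ≤
    ENNReal.ofReal (c * C₀ ^ (3 * d + 1) / A) * ν k q ((S.net k).bigBall i)

variable {S : CubeSystem μ C₀ A}

theorem mem_boundaryIndices {k i j : ℕ} : j ∈ S.boundaryIndices k i ↔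
    j < (S.net (k + 1)).N ∧ (S.cube (k + 1) j ∩ S.layer k i 1).Nonempty := by
  simp [boundaryIndices]

theorem φ_congr {k l : ℕ} (hkl : k ≤ l) {x y : EuclideanSpace ℝ (Fin d)} (hx : x ∈ μ.support)
    (hy : y ∈ μ.support) (h : S.φ l x = S.φ l y) : S.φ k x = S.φ k y := by
  induction l, hkl using Nat.le_induction with
  | base => exact h
  | succ l _ ih => exact ih (by rw [← S.par_φ l x hx, ← S.par_φ l y hy, h])

theorem measurableSet_cube (k i : ℕ) : MeasurableSet (S.cube k i) :=
  Measure.isClosed_support.measurableSet.inter (S.measurable_φ k (measurableSet_singleton i))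

theorem center_mem_cube (hA : 0 < A) {k i : ℕ} (hi : i < (S.net k).N) :
    (S.net k).z i ∈ S.cube k i := by
  have hz := (S.net k).z_mem i hi
  refine ⟨hz, S.φ_eq k _ hz i hi ?_⟩
  rw [dist_self]
  exact (inv_nonneg.2 (by positivity)).trans ((S.net k).le_r i hi)

theorem cube_injective (hA : 0 < A) {k i j : ℕ} (hi : i < (S.net k).N)
    (h : S.cube k i = S.cube k j) : i = j := by
  have h1 := S.center_mem_cube hA hi
  have h2 := h1
  rw [h] at h2
  exact h1.2.symm.trans h2.2

theorem cube_subset {k i : ℕ} : S.cube k i ⊆ closedBall ((S.net k).z i) (28 * (S.net k).r i) := by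
  rintro x ⟨hx, rfl⟩
  exact S.dist_le k x hx

theorem layer_zero_subset (hA : 0 < A) {k i : ℕ} (hi : i < (S.net k).N) :
    S.layer k i 0 ⊆ (S.net k).bigBall i := by
  have hs : 0 < (A ^ k)⁻¹ := by positivity
  have hr := (S.net k).le_r i hi
  intro x hx
  change dist x ((S.net k).z i) ≤ 90 * (S.net k).r i
  rcases mem_boundaryLayer_iff.1 hx with ⟨_, y, hy, hxy⟩ | ⟨hx, -⟩
  · have h1 : dist y ((S.net k).z i) ≤ 28 * (S.net k).r i := S.cube_subset hy
    rw [add_zero] at hxy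
    linarith [dist_triangle x y ((S.net k).z i)]
  · have h1 : dist x ((S.net k).z i) ≤ 28 * (S.net k).r i := S.cube_subset hx
    linarith

theorem layer_antitone (hA : 1 ≤ A) (k i : ℕ) : Antitone (S.layer k i) := by
  intro l m hlm x hx
  have h : (A ^ (k + m))⁻¹ ≤ (A ^ (k + l))⁻¹ :=
    inv_anti₀ (by positivity) (pow_le_pow_right₀ hA (by omega))
  rcases mem_boundaryLayer_iff.1 hx with ⟨hx, y, hy, hxy⟩ | ⟨hx, y, hy, hxy⟩
  · exact mem_boundaryLayer_iff.2 (Or.inl ⟨hx, y, hy, hxy.trans_le h⟩)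
  · exact mem_boundaryLayer_iff.2 (Or.inr ⟨hx, y, hy, hxy.trans_le h⟩)

/-- The nearby point across the boundary of Q lies in another cube of generation `k`, hence outside
the child P containing `x`. So `x` is in the inner part of the layer of P at the same absolute
scale. -/
theorem layer_succ_subset (hA : 1 ≤ A) (k i l : ℕ) :
    S.layer k i (l + 1) ⊆ ⋃ j ∈ S.boundaryIndices k i, S.layer (k + 1) j l := by
  intro x hx
  have hx1 : x ∈ S.layer k i 1 := S.layer_antitone hA k i (by omega) hx
  have hxE : x ∈ μ.support := by
    rcases mem_boundaryLayer_iff.1 hx with ⟨hx, -⟩ | ⟨hx, -⟩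
    · exact hx.1
    · exact hx.1
  refine mem_iUnion₂.2 ⟨S.φ (k + 1) x,
    mem_boundaryIndices.2 ⟨S.φ_lt _ _ hxE, x, ⟨hxE, rfl⟩, hx1⟩, ?_⟩
  have key : ∀ y ∈ μ.support, S.φ k y ≠ S.φ k x → dist x y < (A ^ (k + (l + 1)))⁻¹ →
      x ∈ S.layer (k + 1) (S.φ (k + 1) x) l := by
    intro y hy hne hxy
    rw [show k + (l + 1) = k + 1 + l by ring] at hxy
    refine mem_boundaryLayer_iff.2 (Or.inr ⟨⟨hxE, rfl⟩, y, ⟨hy, fun h => hne ?_⟩, hxy⟩)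
    exact S.φ_congr (Nat.le_succ k) hy hxE h.2
  rcases mem_boundaryLayer_iff.1 hx with ⟨hx, y, hy, hxy⟩ | ⟨hx, y, hy, hxy⟩
  · exact key y hy.1 (fun h => hx.2 ⟨hxE, h.symm.trans hy.2⟩) hxy
  · exact key y hy.1 (fun h => hy.2 ⟨hy.1, h.trans hx.2⟩) hxy

theorem measure_layer_le {c : ℝ} (hA : 1 ≤ A)
    {ν : ℕ → Bool → Measure (EuclideanSpace ℝ (Fin d))} (hS : S.SmallSteps c ν)
    (hν : ∀ k, ν k true = μ) (l : ℕ) : ∀ k, ∀ i < (S.net k).N,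
    μ (S.layer k i l) ≤
      ENNReal.ofReal (c * C₀ ^ (3 * d + 1) / A) ^ l * μ ((S.net k).bigBall i) := by
  induction l with
  | zero =>
    intro k i hi
    simpa using measure_mono (S.layer_zero_subset (by linarith) hi)
  | succ l ih =>
    intro k i hi
    have h1 := hS k i hi true
    simp only [hν] at h1
    calc μ (S.layer k i (l + 1))
        ≤ ∑ j ∈ S.boundaryIndices k i, μ (S.layer (k + 1) j l) :=
          (measure_mono (S.layer_succ_subset hA k i l)).trans (measure_biUnion_finset_le _ _)
      _ ≤ ∑ j ∈ S.boundaryIndices k i, ENNReal.ofReal (c * C₀ ^ (3 * d + 1) / A) ^ l *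
            μ ((S.net (k + 1)).bigBall j) :=
          Finset.sum_le_sum fun j hj => ih (k + 1) j (mem_boundaryIndices.1 hj).1
      _ ≤ _ := by
          rw [← Finset.mul_sum, pow_succ (ENNReal.ofReal _), mul_assoc]
          gcongr

/-- The index of a cube given as a set. -/
noncomputable def indexOf (S : CubeSystem μ C₀ A) (k : ℕ)
    (Q : Set (EuclideanSpace ℝ (Fin d))) : ℕ :=
  sInf {i | i < (S.net k).N ∧ Q = S.cube k i}

theorem indexOf_cube (hA : 0 < A) {k i : ℕ} (hi : i < (S.net k).N) :
    S.indexOf k (S.cube k i) = i := by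
  have h : {j | j < (S.net k).N ∧ S.cube k i = S.cube k j} = {i} := by
    ext j
    simp only [mem_ofPred_eq, mem_singleton_iff]
    exact ⟨fun h => (S.cube_injective hA hi h.2).symm, by rintro rfl; exact ⟨hi, rfl⟩⟩
  rw [indexOf, h, csInf_singleton]

/-- The David–Mattila lattice formed by the cubes of a system. -/
noncomputable def toDMLattice (S : CubeSystem μ C₀ A) (hA : 1 ≤ A) {c : ℝ}
    (hsmall : ∀ k, ∀ i < (S.net k).N, ∀ l, μ (S.layer k i l) ≤
      ENNReal.ofReal (c * C₀ ^ (3 * d + 1) / A) ^ l * μ ((S.net k).bigBall i))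
    (hC₀ : 0 ≤ C₀) (hc : 0 ≤ c) : DMLattice μ c C₀ A where
  cubes k := {Q | ∃ i < (S.net k).N, Q = S.cube k i}
  center k Q := (S.net k).z (S.indexOf k Q)
  radius k Q := (S.net k).r (S.indexOf k Q)
  measurableSet_cube := by
    rintro k _ ⟨i, _, rfl⟩
    exact S.measurableSet_cube k i
  sUnion_cubes k := by
    ext x
    constructor
    · rintro ⟨_, ⟨i, _, rfl⟩, hx⟩
      exact hx.1
    · exact fun hx => ⟨S.cube k (S.φ k x), ⟨_, S.φ_lt k x hx, rfl⟩, hx, rfl⟩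
  disjoint_cubes := by
    rintro k _ ⟨i, _, rfl⟩ _ ⟨j, _, rfl⟩ hne
    rw [Function.onFun, Set.disjoint_left]
    rintro x ⟨_, rfl⟩ ⟨_, h⟩
    exact hne (by rw [h])
  nested := by
    rintro k l hkl _ ⟨i, _, rfl⟩ _ ⟨j, _, rfl⟩
    by_cases h : ∃ x, x ∈ S.cube l i ∧ x ∈ S.cube k j
    · obtain ⟨x, h1, h2⟩ := h
      refine Or.inr fun y hy => ⟨hy.1, ?_⟩
      rw [S.φ_congr hkl.le hy.1 h1.1 (hy.2.trans h1.2.symm), h2.2]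
    · exact Or.inl (Set.disjoint_left.2 fun x h1 h2 => h ⟨x, h1, h2⟩)
  center_mem := by
    rintro k _ ⟨i, hi, rfl⟩
    rw [S.indexOf_cube (by linarith) hi]
    exact (S.net k).z_mem i hi
  le_radius := by
    rintro k _ ⟨i, hi, rfl⟩
    rw [S.indexOf_cube (by linarith) hi]
    exact (S.net k).le_r i hi
  radius_le := by
    rintro k _ ⟨i, hi, rfl⟩
    rw [S.indexOf_cube (by linarith) hi]
    exact (S.net k).r_le i hi
  ball_subset := by
    rintro k _ ⟨i, hi, rfl⟩
    rw [S.indexOf_cube (by linarith) hi]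
    exact fun x hx => ⟨hx.1, S.φ_eq k x hx.1 i hi hx.2⟩
  subset_ball := by
    rintro k _ ⟨i, hi, rfl⟩
    rw [S.indexOf_cube (by linarith) hi]
    exact S.cube_subset
  disjoint_balls := by
    rintro k _ ⟨i, hi, rfl⟩ _ ⟨j, hj, rfl⟩ hne
    rw [Function.onFun, S.indexOf_cube (by linarith) hi, S.indexOf_cube (by linarith) hj]
    exact closedBall_disjoint_closedBall
      ((S.net k).sep i hi j hj fun h => hne (by rw [h]))
  small_boundary := by
    rintro k _ ⟨i, hi, rfl⟩ l
    rw [S.indexOf_cube (by linarith) hi]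
    have e : ENNReal.ofReal (c * C₀ ^ (3 * d + 1) / A) ^ l =
        ENNReal.ofReal (((c⁻¹ * (C₀ ^ (3 * d + 1))⁻¹ * A) ^ l)⁻¹) := by
      rw [← ENNReal.ofReal_pow (by positivity), ← inv_pow]
      congr 2
      simp only [mul_inv, inv_inv]
      ring
    rw [← e]
    exact hsmall k i hi l
  radius_eq_of_not_doubling := by
    rintro k _ ⟨i, hi, rfl⟩
    rw [S.indexOf_cube (by linarith) hi]
    exact fun h => (((S.net k).doubling i hi).resolve_left h).1
  growth_of_not_doubling := by
    rintro k _ ⟨i, hi, rfl⟩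
    rw [S.indexOf_cube (by linarith) hi]
    exact fun h => (((S.net k).doubling i hi).resolve_left h).2

/-! ### Construction of the cube system. -/

theorem exists_smallSteps (hC : 1 < C₀) (hA : 5000 * C₀ < A) (hμ : IsCompact μ.support)
    (ν : ℕ → Bool → Measure (EuclideanSpace ℝ (Fin d))) :
    ∃ S : CubeSystem μ C₀ A, S.SmallSteps (4800 * 1900 ^ d) ν := by
  have hA0 : 0 < A := by linarith
  have hs : ∀ k : ℕ, 0 < (A ^ k)⁻¹ := fun k => by positivity
  have hss : ∀ k : ℕ, (A ^ (k + 1))⁻¹ = (A ^ k)⁻¹ / A := fun k => by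
    rw [pow_succ, mul_inv, div_eq_mul_inv]
  have hss' : ∀ k : ℕ, 5000 * (C₀ * (A ^ (k + 1))⁻¹) ≤ (A ^ k)⁻¹ := fun k => by
    rw [hss, show 5000 * (C₀ * ((A ^ k)⁻¹ / A)) = (A ^ k)⁻¹ * (5000 * C₀ / A) by ring]
    have : 5000 * C₀ / A ≤ 1 := by rw [div_le_one hA0]; exact hA.le
    nlinarith [hs k]
  let B : ∀ k : ℕ, BallNet μ C₀ (A ^ k)⁻¹ := fun k => (BallNet.nonempty μ hC (hs k) hμ).some
  -- Inner radii in [2r, 3r] leave room around B for moving a point to the center of its child and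
  -- stay below 5r; outer radii in [20r, 21r] keep the covering property.
  choose a ha1 ha2 ha3 using fun k j => (B k).exists_cut (hs k) hC hA (ν k) j (2 * (B k).r j)
  choose b hb1 hb2 hb3 using fun k j => (B k).exists_cut (hs k) hC hA (ν k) j (20 * (B k).r j)
  have ha5 : ∀ k, ∀ j < (B k).N, a k j ≤ 5 * (B k).r j := fun k j hj => by
    linarith [ha2 k j, (B k).le_r j hj, hs k]
  have hb21 : ∀ k, ∀ j < (B k).N, b k j ≤ 21 * (B k).r j := fun k j hj => by
    linarith [hb2 k j, (B k).le_r j hj, hs k]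
  have hab : ∀ k, ∀ j < (B k).N, a k j ≤ b k j := fun k j hj => by
    linarith [ha2 k j, hb1 k j, (B k).le_r j hj, hs k]
  set ι : ℕ → EuclideanSpace ℝ (Fin d) → ℕ := fun k => (B k).index (a k) (b k)
  set z : ℕ → ℕ → EuclideanSpace ℝ (Fin d) := fun k => (B k).z
  have hspec : ∀ k, ∀ x ∈ μ.support, ι k x < (B k).N ∧ dist x (z k (ι k x)) ≤ b k (ι k x) :=
    fun k x hx => BallNet.index_spec (fun j _ => hb1 k j) (hab k) hx
  have hι : ∀ k, ∀ x ∈ μ.support, ι k x < (B k).N := fun k x hx => (hspec k x hx).1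
  have hz : ∀ k, ∀ i < (B k).N, z k i ∈ μ.support := fun k => (B k).z_mem
  set φ := treeIndex ι z
  have hφlt : ∀ k, ∀ x ∈ μ.support, φ k x < (B k).N := by
    intro k x hx
    obtain ⟨m, hm⟩ := (frequently_treeAncestor_treeIndex hι hz hx k).1.exists
    change treeIndex ι z k x < _
    rw [← hm]
    exact treeAncestor_lt hι hz hx m k
  have hpar : ∀ k, ∀ x ∈ μ.support, ι k (z (k + 1) (φ (k + 1) x)) = φ k x := fun k x hx =>
    (frequently_treeAncestor_treeIndex hι hz hx k).2
  have hφdist : ∀ k, ∀ x ∈ μ.support, dist x (z k (φ k x)) ≤ 42 * (C₀ * (A ^ k)⁻¹) := by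
    intro k x hx
    obtain ⟨m, hm⟩ := (frequently_treeAncestor_treeIndex hι hz hx k).1.exists
    have h := dist_treeAncestor_le hι hz (A := A) (D := 21 * C₀) (by linarith) (by linarith)
      (fun k x hx => by
        have h1 := hspec k x hx
        have h2 := hb21 k _ h1.1
        have h3 := (B k).r_le _ h1.1
        linarith [h1.2]) hx m k
    rw [hm] at h
    linarith
  -- Going through the center of the child bounds the distance by the radius of the parent ball
  -- itself rather than by C₀ A^{-k}, as needed for 28B.
  have hdist' : ∀ k, ∀ x ∈ μ.support,
      dist (z (k + 1) (φ (k + 1) x)) (z k (φ k x)) ≤ 21 * (B k).r (φ k x) := by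
    intro k x hx
    have h1 := hspec k _ (hz _ _ (hφlt (k + 1) x hx))
    rw [hpar k x hx] at h1
    exact h1.2.trans (hb21 k _ h1.1)
  refine ⟨⟨B, φ, fun k i => ι k (z (k + 1) i), measurable_treeIndex fun k =>
    (B k).measurable_index _ _, hφlt, hpar, ?_, ?_⟩, ?_⟩
  · intro k x hx i hi h
    rw [← hpar k x hx]
    refine BallNet.index_eq (ha5 k) hi ?_
    have h1 := hφdist (k + 1) x hx
    have h2 := dist_triangle_left (z (k + 1) (φ (k + 1) x)) ((B k).z i) x
    linarith [ha1 k i, (B k).le_r i hi, hss' k, hs k]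
  · intro k x hx
    have h1 := hφdist (k + 1) x hx
    have h2 := dist_triangle x (z (k + 1) (φ (k + 1) x)) (z k (φ k x))
    have h3 := hdist' k x hx
    have h4 := (B k).le_r _ (hφlt k x hx)
    change dist x (z k (φ k x)) ≤ 28 * (B k).r (φ k x)
    linarith [hss' k, hs k]
  · intro k i hi q
    refine BallNet.sum_bigBall_le (a := a k) (b := b k) (hs k) hC hA (hss k) (B (k + 1))
      (ν k) (ha5 k) (hb21 k) ?_ hi _ (fun l hl => ?_) q
    · rintro j hj ρ (rfl | rfl)
      · exact ha3 k j
      · exact hb3 k j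
    · obtain ⟨hl, p, hp, hp'⟩ := mem_boundaryIndices.1 hl
      refine ⟨hl, ?_⟩
      obtain ⟨hpE, hpl⟩ := hp
      have e85 : 85 * C₀ * (A ^ k)⁻¹ / A = 85 * (C₀ * (A ^ (k + 1))⁻¹) := by rw [hss]; ring
      have hone : (A ^ (k + 1))⁻¹ ≤ C₀ * (A ^ (k + 1))⁻¹ := by nlinarith [hs (k + 1)]
      -- Parents are decided at the centers of the children, so nearby points of different cubes are
      -- replaced by these centers, which have different values of `ι k`. The constant is 85 = 42 +
      -- 1 + 42.
      have hclose : ∀ x ∈ μ.support, ∀ y ∈ μ.support, dist x y < (A ^ (k + 1))⁻¹ →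
          dist (z (k + 1) (φ (k + 1) x)) (z (k + 1) (φ (k + 1) y)) ≤ 85 * C₀ * (A ^ k)⁻¹ / A := by
        intro x hx y hy hxy
        have h1 := hφdist (k + 1) x hx
        have h2 := hφdist (k + 1) y hy
        have h3 := dist_triangle4 (z (k + 1) (φ (k + 1) x)) x y (z (k + 1) (φ (k + 1) y))
        rw [dist_comm _ x] at h3
        rw [e85]
        linarith
      have hlz : (B (k + 1)).z l = z (k + 1) (φ (k + 1) p) := by rw [← hpl]
      rw [hlz]
      rcases mem_boundaryLayer_iff.1 hp' with ⟨hpQ, y, hy, hpy⟩ | ⟨hpQ, y, hy, hpy⟩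
      · rw [dist_comm] at hpy
        refine ⟨_, _, hclose y hy.1 p hpE hpy, Or.inr rfl, ?_, ?_⟩
        · have h1 := hdist' k y hy.1
          rw [show φ k y = i from hy.2] at h1
          exact h1
        · change ι k _ ≠ ι k _
          rw [hpar k y hy.1, hpar k p hpE]
          exact fun h => hpQ.2 ⟨hpE, h.symm.trans hy.2⟩
      · refine ⟨_, _, hclose p hpE y hy.1 hpy, Or.inl rfl, ?_, ?_⟩
        · have h1 := hdist' k p hpE
          rw [show φ k p = i from hpQ.2] at h1
          exact h1
        · change ι k _ ≠ ι k _
          rw [hpar k y hy.1, hpar k p hpE]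
          exact fun h => hy.2 ⟨hy.1, h.symm.trans hpQ.2⟩

end CubeSystem

/-! ### Weighted density measures and the interaction across a boundary. -/

theorem ENNReal.add_sq_le (x y : ℝ≥0∞) : (x + y) ^ 2 ≤ 2 * (x ^ 2 + y ^ 2) := by
  rcases eq_or_ne x ∞ with rfl | hx
  · simp [ENNReal.mul_top]
  rcases eq_or_ne y ∞ with rfl | hy
  · simp [ENNReal.mul_top]
  lift x to ℝ≥0 using hx
  lift y to ℝ≥0 using hy
  exact_mod_cast _root_.add_sq_le (a := x) (b := y)

/-- Cauchy–Schwarz with geometric weights; peeling off the first term doubles the weights of the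
remaining ones. -/
theorem ENNReal.sq_tsum_le (u : ℕ → ℝ≥0∞) :
    (∑' j, u j) ^ 2 ≤ 2 * ∑' j, 2 ^ j * u j ^ 2 := by
  have hfin : ∀ N : ℕ, ∀ u : ℕ → ℝ≥0∞, (∑ j ∈ Finset.range N, u j) ^ 2 ≤
      2 * ∑ j ∈ Finset.range N, 2 ^ j * u j ^ 2 := by
    intro N
    induction N with
    | zero => simp
    | succ N ih =>
      intro u
      rw [Finset.sum_range_succ', Finset.sum_range_succ']
      calc (∑ j ∈ Finset.range N, u (j + 1) + u 0) ^ 2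
          ≤ 2 * ((∑ j ∈ Finset.range N, u (j + 1)) ^ 2 + u 0 ^ 2) := ENNReal.add_sq_le _ _
        _ ≤ 2 * (2 * ∑ j ∈ Finset.range N, 2 ^ j * u (j + 1) ^ 2 + u 0 ^ 2) := by
            gcongr
            exact ih _
        _ = _ := by
            rw [Finset.mul_sum]
            simp only [pow_succ, pow_zero, one_mul]
            congr 2
            exact Finset.sum_congr rfl fun j _ => by ring
  refine le_of_tendsto' (ENNReal.Tendsto.pow (ENNReal.tendsto_nat_tsum u)) fun N =>
    (hfin N u).trans ?_
  gcongr
  exact ENNReal.sum_le_tsum _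

section LocalDensity

variable {d : ℕ} (μ : Measure (EuclideanSpace ℝ (Fin d))) (n : ℕ) (A : ℝ)

/-- The density of the ball of center `x` and radius `28 A^{-i}`, up to a constant factor. -/
noncomputable def localDensity (i : ℕ) (x : EuclideanSpace ℝ (Fin d)) : ℝ≥0∞ :=
  μ (closedBall x (28 * (A ^ i)⁻¹)) * ENNReal.ofReal (A ^ i) ^ n

/-- The measure whose density is the square of the local density at scale `A^{-i}`. -/
noncomputable def scaleMeasure (i : ℕ) : Measure (EuclideanSpace ℝ (Fin d)) :=
  μ.withDensity fun x => localDensity μ n A i x ^ 2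

/-- The sum of the measures `scaleMeasure μ n A (k + l)` with the weights `a ^ l`. -/
noncomputable def tailMeasure (a : ℝ≥0∞) (k : ℕ) : Measure (EuclideanSpace ℝ (Fin d)) :=
  Measure.sum fun l => a ^ l • scaleMeasure μ n A (k + l)

variable {μ n A}

theorem measurable_localDensity [SFinite μ] (i : ℕ) : Measurable (localDensity μ n A i) := by
  have h : MeasurableSet {p : EuclideanSpace ℝ (Fin d) × EuclideanSpace ℝ (Fin d) |
      dist p.2 p.1 ≤ 28 * (A ^ i)⁻¹} := measurableSet_le (by fun_prop) measurable_const
  exact (measurable_measure_prodMk_left h).mul_const _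

theorem tailMeasure_apply {a : ℝ≥0∞} {k : ℕ} {U : Set (EuclideanSpace ℝ (Fin d))}
    (hU : MeasurableSet U) :
    tailMeasure μ n A a k U = ∑' l, a ^ l * scaleMeasure μ n A (k + l) U := by
  simp [tailMeasure, Measure.sum_apply _ hU]

theorem scaleMeasure_le_tailMeasure {a : ℝ≥0∞} {k : ℕ} {U : Set (EuclideanSpace ℝ (Fin d))}
    (hU : MeasurableSet U) : scaleMeasure μ n A k U ≤ tailMeasure μ n A a k U := by
  rw [tailMeasure_apply hU]
  simpa using ENNReal.le_tsum (f := fun l => a ^ l * scaleMeasure μ n A (k + l) U) 0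

/-- Shifting the series: changing generation costs exactly one factor 1/a. -/
theorem mul_tailMeasure_succ_le {a : ℝ≥0∞} {k : ℕ} {U : Set (EuclideanSpace ℝ (Fin d))}
    (hU : MeasurableSet U) :
    a * tailMeasure μ n A a (k + 1) U ≤ tailMeasure μ n A a k U := by
  rw [tailMeasure_apply hU, tailMeasure_apply hU, ← ENNReal.tsum_mul_left,
    tsum_eq_zero_add' (f := fun l => a ^ l * scaleMeasure μ n A (k + l) U) ENNReal.summable]
  refine le_trans (le_of_eq (tsum_congr fun l => ?_)) le_add_self
  rw [show k + 1 + l = k + (l + 1) by ring, pow_succ]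
  ring

end LocalDensity

namespace CubeSystem

variable {d : ℕ} {μ : Measure (EuclideanSpace ℝ (Fin d))} {C₀ A : ℝ} {S : CubeSystem μ C₀ A}
  {n : ℕ} {a b : ℝ≥0∞} {c : ℝ} {ν : ℕ → Bool → Measure (EuclideanSpace ℝ (Fin d))}

theorem measurableSet_layer (k i l : ℕ) : MeasurableSet (S.layer k i l) :=
  measurableSet_boundaryLayer Measure.isClosed_support.measurableSet (S.measurableSet_cube k i) _

/-- Induction on the number of scales, for all cubes at once. The layers of Q are covered by those
of its boundary children, and `hab` says that the small proportion beats the losses 2, b and 1/a, so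
the constant does not grow. -/
theorem sum_scaleMeasure_layer_le (hA : 1 ≤ A) (hS : S.SmallSteps c ν)
    (hν : ∀ k, ν k false = tailMeasure μ n A a k) (ha0 : a ≠ 0) (ha : a ≠ ∞)
    (hab : 2 * b * ENNReal.ofReal (c * C₀ ^ (3 * d + 1) / A) ≤ a) (M : ℕ) :
    ∀ k, ∀ i < (S.net k).N,
    ∑ l ∈ Finset.range M, b ^ (l + 1) * scaleMeasure μ n A (k + (l + 1)) (S.layer k i (l + 1)) ≤
      tailMeasure μ n A a k ((S.net k).bigBall i) := by
  have hball : ∀ k i, MeasurableSet ((S.net k).bigBall i) :=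
    fun k i => isClosed_closedBall.measurableSet
  induction M with
  | zero => simp
  | succ M ih =>
    intro k i hi
    have h1 := hS k i hi false
    simp only [hν] at h1
    have hstep : ∑ l ∈ Finset.range (M + 1),
        b ^ (l + 1) * scaleMeasure μ n A (k + (l + 1)) (S.layer k i (l + 1)) ≤
        b * ∑ j ∈ S.boundaryIndices k i, 2 *
          tailMeasure μ n A a (k + 1) ((S.net (k + 1)).bigBall j) := by
      calc _ ≤ ∑ l ∈ Finset.range (M + 1), b ^ (l + 1) * ∑ j ∈ S.boundaryIndices k i,
            scaleMeasure μ n A (k + 1 + l) (S.layer (k + 1) j l) := by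
            refine Finset.sum_le_sum fun l _ => ?_
            rw [show k + (l + 1) = k + 1 + l by ring]
            gcongr
            exact (measure_mono (S.layer_succ_subset hA k i l)).trans
              (measure_biUnion_finset_le _ _)
        _ = b * ∑ j ∈ S.boundaryIndices k i, ∑ l ∈ Finset.range (M + 1),
            b ^ l * scaleMeasure μ n A (k + 1 + l) (S.layer (k + 1) j l) := by
            rw [Finset.sum_comm, Finset.mul_sum]
            refine Finset.sum_congr rfl fun l _ => ?_
            rw [Finset.mul_sum, Finset.mul_sum]
            refine Finset.sum_congr rfl fun j _ => ?_
            rw [pow_succ]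
            ring
        _ ≤ _ := by
            gcongr with j hj
            have hj' := (mem_boundaryIndices.1 hj).1
            -- The layer 0 of the child and all its deeper layers each cost one tail measure; this
            -- is the factor 2 in `hab`.
            rw [Finset.sum_range_succ', two_mul, pow_zero, one_mul, add_zero]
            refine add_le_add ?_ ?_
            · exact ih (k + 1) j hj'
            · exact (measure_mono (S.layer_zero_subset (by linarith) hj')).trans
                (scaleMeasure_le_tailMeasure (hball _ _))
    rw [← ENNReal.mul_le_mul_iff_right ha0 ha]
    calc _ ≤ a * (b * ∑ j ∈ S.boundaryIndices k i, 2 *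
          tailMeasure μ n A a (k + 1) ((S.net (k + 1)).bigBall j)) := by gcongr
      _ = 2 * b * ∑ j ∈ S.boundaryIndices k i,
          a * tailMeasure μ n A a (k + 1) ((S.net (k + 1)).bigBall j) := by
          simp only [← Finset.mul_sum]
          ring
      _ ≤ 2 * b * ∑ j ∈ S.boundaryIndices k i,
          tailMeasure μ n A a k ((S.net (k + 1)).bigBall j) := by
          gcongr with j hj
          exact mul_tailMeasure_succ_le (hball _ _)
      _ ≤ 2 * b * (ENNReal.ofReal (c * C₀ ^ (3 * d + 1) / A) *
          tailMeasure μ n A a k ((S.net k).bigBall i)) := by gcongr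
      _ ≤ _ := by
          rw [← mul_assoc]
          gcongr

theorem tsum_scaleMeasure_layer_le (hA : 1 ≤ A) (hS : S.SmallSteps c ν)
    (hν : ∀ k, ν k false = tailMeasure μ n A a k) (ha0 : a ≠ 0) (ha : a ≠ ∞)
    (hab : 2 * b * ENNReal.ofReal (c * C₀ ^ (3 * d + 1) / A) ≤ a) {k i : ℕ}
    (hi : i < (S.net k).N) :
    ∑' l, b ^ l * scaleMeasure μ n A (k + l) (S.layer k i l) ≤
      2 * tailMeasure μ n A a k ((S.net k).bigBall i) := by
  rw [tsum_eq_zero_add' (f := fun l => b ^ l * scaleMeasure μ n A (k + l) (S.layer k i l))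
    ENNReal.summable, two_mul]
  refine add_le_add ?_ (ENNReal.tsum_le_of_sum_range_le fun M =>
    sum_scaleMeasure_layer_le hA hS hν ha0 ha hab M k i hi)
  rw [pow_zero, one_mul, add_zero]
  exact (measure_mono (S.layer_zero_subset (by linarith) hi)).trans
    (scaleMeasure_le_tailMeasure isClosed_closedBall.measurableSet)

/-- Distances at least A^{-k} are covered by the first summand; otherwise the single `l` with
A^{-k-l-1} ≤ |x - y| < A^{-k-l} suffices. -/
theorem inv_edist_pow_le (hA : 1 < A) {x y : EuclideanSpace ℝ (Fin d)} (hxy : x ≠ y) {k i : ℕ}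
    (h : ∀ l, dist x y < (A ^ (k + l))⁻¹ → x ∈ S.layer k i l) :
    (edist x y ^ n)⁻¹ ≤ ENNReal.ofReal (A ^ k) ^ n +
      ∑' l, (S.layer k i l).indicator 1 x *
        ((closedBall x (28 * (A ^ (k + l))⁻¹)).indicator 1 y *
          ENNReal.ofReal (A ^ (k + l + 1)) ^ n) := by
  have hA0 : 0 < A := by linarith
  have hd : 0 < dist x y := dist_pos.2 hxy
  have key : ∀ m : ℕ, (A ^ m)⁻¹ ≤ dist x y → (edist x y ^ n)⁻¹ ≤ ENNReal.ofReal (A ^ m) ^ n := by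
    intro m hm
    rw [ENNReal.inv_pow]
    gcongr
    rw [edist_dist, ← ENNReal.ofReal_inv_of_pos hd]
    exact ENNReal.ofReal_le_ofReal (inv_le_of_inv_le₀ (by positivity) hm)
  by_cases h0 : (A ^ k)⁻¹ ≤ dist x y
  · exact (key k h0).trans le_self_add
  have hex : ∃ l : ℕ, (A ^ (k + l + 1))⁻¹ ≤ dist x y := by
    obtain ⟨l, hl⟩ := pow_unbounded_of_one_lt (dist x y)⁻¹ hA
    refine ⟨l, inv_le_of_inv_le₀ hd (hl.le.trans ?_)⟩
    exact pow_le_pow_right₀ hA.le (by omega)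
  classical
  obtain ⟨l, hl, hmin⟩ : ∃ l : ℕ, (A ^ (k + l + 1))⁻¹ ≤ dist x y ∧ dist x y < (A ^ (k + l))⁻¹ := by
    refine ⟨Nat.find hex, Nat.find_spec hex, ?_⟩
    rcases hl : Nat.find hex with _ | l
    · exact not_le.1 h0
    · exact not_le.1 (Nat.find_min hex (m := l) (by omega))
  refine (key _ hl).trans (le_add_left ?_)
  refine le_trans ?_ (ENNReal.le_tsum l)
  have hx := h l hmin
  have hy : y ∈ closedBall x (28 * (A ^ (k + l))⁻¹) := by
    have : 0 < (A ^ (k + l))⁻¹ := by positivity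
    rw [mem_closedBall, dist_comm]
    linarith
  rw [indicator_of_mem hx, indicator_of_mem hy]
  simp

theorem interaction_le [SFinite μ] (hμ : μ μ.supportᶜ = 0) (hA : 1 < A) (hb : 2 ≤ b) {k i : ℕ}
    {U T : Set (EuclideanSpace ℝ (Fin d))} (hU : MeasurableSet U) (hT : MeasurableSet T)
    (h : ∀ x ∈ U ∩ μ.support, ∀ y ∈ T ∩ μ.support, x ≠ y ∧
      ∀ l, dist x y < (A ^ (k + l))⁻¹ → x ∈ S.layer k i l) :
    interaction μ n U T ≤ 2 * ((ENNReal.ofReal (A ^ k) ^ n * μ T) ^ 2 * μ U) +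
      4 * ENNReal.ofReal A ^ (2 * n) *
        ∑' l, b ^ l * scaleMeasure μ n A (k + l) (S.layer k i l) := by
  have hA0 : 0 < A := by linarith
  have hae : ∀ᵐ x ∂μ, x ∈ μ.support := hμ
  set ψ : ℕ → EuclideanSpace ℝ (Fin d) → ℝ≥0∞ := fun l =>
    (S.layer k i l).indicator (localDensity μ n A (k + l)) with hψ
  have hψm : ∀ l, Measurable (ψ l) := fun l =>
    (measurable_localDensity _).indicator (S.measurableSet_layer k i l)
  have hinner : ∀ x ∈ U ∩ μ.support, ∫⁻ y in T, (edist x y ^ n)⁻¹ ∂μ ≤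
      ENNReal.ofReal (A ^ k) ^ n * μ T + ENNReal.ofReal A ^ n * ∑' l, ψ l x := by
    intro x hx
    have hind : ∀ l, Measurable
        ((closedBall x (28 * (A ^ (k + l))⁻¹)).indicator (1 : EuclideanSpace ℝ (Fin d) → ℝ≥0∞)) :=
      fun l => measurable_one.indicator isClosed_closedBall.measurableSet
    calc ∫⁻ y in T, (edist x y ^ n)⁻¹ ∂μ
        ≤ ∫⁻ y in T, (ENNReal.ofReal (A ^ k) ^ n + ∑' l, (S.layer k i l).indicator 1 x *
          ((closedBall x (28 * (A ^ (k + l))⁻¹)).indicator 1 y *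
            ENNReal.ofReal (A ^ (k + l + 1)) ^ n)) ∂μ := by
          refine lintegral_mono_ae ?_
          filter_upwards [ae_restrict_mem hT, ae_restrict_of_ae hae] with y hy hyE
          obtain ⟨h1, h2⟩ := h x hx y ⟨hy, hyE⟩
          exact inv_edist_pow_le hA h1 h2
      _ = ENNReal.ofReal (A ^ k) ^ n * μ T + ∑' l, (S.layer k i l).indicator 1 x *
          (μ (closedBall x (28 * (A ^ (k + l))⁻¹) ∩ T) *
            ENNReal.ofReal (A ^ (k + l + 1)) ^ n) := by
          rw [lintegral_add_left measurable_const, lintegral_tsum fun l =>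
            (((hind l).mul_const _).const_mul _).aemeasurable]
          simp only [lintegral_const, Measure.restrict_apply MeasurableSet.univ, univ_inter]
          congr 1
          refine tsum_congr fun l => ?_
          rw [lintegral_const_mul _ ((hind l).mul_const _), lintegral_mul_const _ (hind l),
            lintegral_indicator_one isClosed_closedBall.measurableSet,
            Measure.restrict_apply isClosed_closedBall.measurableSet]
      _ ≤ _ := by
          rw [← ENNReal.tsum_mul_left]
          refine add_le_add le_rfl (ENNReal.tsum_le_tsum fun l => ?_)
          by_cases hxl : x ∈ S.layer k i l
          · simp only [hψ, indicator_of_mem hxl, Pi.one_apply, one_mul, localDensity]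
            rw [pow_succ, ENNReal.ofReal_mul (by positivity), mul_pow, ← mul_assoc, mul_comm]
            refine mul_le_mul' le_rfl (mul_le_mul' (measure_mono ?_) le_rfl)
            exact inter_subset_left
          · simp [hψ, indicator_of_notMem hxl]
  have hsq : ∀ x ∈ U ∩ μ.support, (∫⁻ y in T, (edist x y ^ n)⁻¹ ∂μ) ^ 2 ≤
      2 * (ENNReal.ofReal (A ^ k) ^ n * μ T) ^ 2 +
        4 * ENNReal.ofReal A ^ (2 * n) * ∑' l, b ^ l * ψ l x ^ 2 := by
    intro x hx
    calc _ ≤ (ENNReal.ofReal (A ^ k) ^ n * μ T + ENNReal.ofReal A ^ n * ∑' l, ψ l x) ^ 2 := by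
          gcongr
          exact hinner x hx
      _ ≤ 2 * ((ENNReal.ofReal (A ^ k) ^ n * μ T) ^ 2 + (ENNReal.ofReal A ^ n * ∑' l, ψ l x) ^ 2) :=
          ENNReal.add_sq_le _ _
      _ ≤ 2 * ((ENNReal.ofReal (A ^ k) ^ n * μ T) ^ 2 +
          (ENNReal.ofReal A ^ n) ^ 2 * (2 * ∑' l, b ^ l * ψ l x ^ 2)) := by
          rw [mul_pow (ENNReal.ofReal A ^ n)]
          gcongr
          refine (ENNReal.sq_tsum_le _).trans ?_
          gcongr
      _ = _ := by ring
  calc interaction μ n U T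
      ≤ ∫⁻ x in U, (2 * (ENNReal.ofReal (A ^ k) ^ n * μ T) ^ 2 +
        4 * ENNReal.ofReal A ^ (2 * n) * ∑' l, b ^ l * ψ l x ^ 2) ∂μ := by
        refine lintegral_mono_ae ?_
        filter_upwards [ae_restrict_mem hU, ae_restrict_of_ae hae] with x hx hxE
        exact hsq x ⟨hx, hxE⟩
    _ = 2 * ((ENNReal.ofReal (A ^ k) ^ n * μ T) ^ 2 * μ U) +
        4 * ENNReal.ofReal A ^ (2 * n) * ∑' l, b ^ l * ∫⁻ x in U, ψ l x ^ 2 ∂μ := by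
        rw [lintegral_add_left measurable_const, lintegral_const_mul _
          (Measurable.tsum fun l => ((hψm l).pow_const 2).const_mul _),
          lintegral_tsum fun l => (((hψm l).pow_const 2).const_mul _).aemeasurable]
        simp only [lintegral_const, Measure.restrict_apply MeasurableSet.univ, univ_inter,
          mul_assoc]
        congr 4
        funext l
        rw [lintegral_const_mul _ ((hψm l).pow_const 2)]
    _ ≤ _ := by
        gcongr with l
        refine (setLIntegral_le_lintegral _ _).trans (le_of_eq ?_)
        rw [scaleMeasure, withDensity_apply _ (S.measurableSet_layer k i l),
          ← lintegral_indicator (S.measurableSet_layer k i l)]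
        refine lintegral_congr fun x => ?_
        by_cases hxl : x ∈ S.layer k i l
        · simp [hψ, indicator_of_mem hxl]
        · simp [hψ, indicator_of_notMem hxl]

end CubeSystem

/-! ### Comparison with the energy of the lattice. -/

namespace CubeSystem

variable {d : ℕ} {μ : Measure (EuclideanSpace ℝ (Fin d))} {c C₀ A : ℝ}

/-- The lattice `L` consists of the cubes of the system `S`, with the balls of its nets. -/
structure Represents (S : CubeSystem μ C₀ A) (L : DMLattice μ c C₀ A) : Prop where
  mem_cubes : ∀ k Q, Q ∈ L.cubes k ↔ ∃ i < (S.net k).N, Q = S.cube k i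
  center_cube : ∀ k, ∀ i < (S.net k).N, L.center k (S.cube k i) = (S.net k).z i
  radius_cube : ∀ k, ∀ i < (S.net k).N, L.radius k (S.cube k i) = (S.net k).r i

theorem represents_toDMLattice (S : CubeSystem μ C₀ A) (hA : 1 ≤ A)
    (hsmall : ∀ k, ∀ i < (S.net k).N, ∀ l, μ (S.layer k i l) ≤
      ENNReal.ofReal (c * C₀ ^ (3 * d + 1) / A) ^ l * μ ((S.net k).bigBall i))
    (hC₀ : 0 ≤ C₀) (hc : 0 ≤ c) : S.Represents (S.toDMLattice hA hsmall hC₀ hc) where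
  mem_cubes _ _ := Iff.rfl
  center_cube k i hi := congrArg (S.net k).z (S.indexOf_cube (by linarith) hi)
  radius_cube k i hi := congrArg (S.net k).r (S.indexOf_cube (by linarith) hi)

variable {S : CubeSystem μ C₀ A} {L : DMLattice μ c C₀ A} {n : ℕ} {γ : ℝ}

theorem Represents.twoBall_cube (h : S.Represents L) {k i : ℕ} (hi : i < (S.net k).N) :
    L.twoBall k (S.cube k i) = closedBall ((S.net k).z i) (2 * (28 * (S.net k).r i)) := by
  rw [DMLattice.twoBall, h.center_cube k i hi, h.radius_cube k i hi]

theorem Represents.twoBallDensity_cube (h : S.Represents L) {k i : ℕ} (hi : i < (S.net k).N) :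
    L.twoBallDensity n k (S.cube k i) =
      ballDensity μ n ((S.net k).z i) (2 * (28 * (S.net k).r i)) := by
  rw [DMLattice.twoBallDensity, h.center_cube k i hi, h.radius_cube k i hi]

theorem Represents.mul_measure_twoBall_le (h : S.Represents L) (hA : 1 < A) {k i : ℕ}
    (hi : i < (S.net k).N) :
    ENNReal.ofReal (A ^ k) ^ n * μ (L.twoBall k (S.cube k i)) ≤
      ENNReal.ofReal (56 * C₀) ^ n * L.twoBallDensity n k (S.cube k i) := by
  have hA0 : 0 < A := by linarith
  have hr : 0 < (S.net k).r i := lt_of_lt_of_le (by positivity) ((S.net k).le_r i hi)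
  have hr' := (S.net k).r_le i hi
  set R := 2 * (28 * (S.net k).r i) with hR
  have hR0 : 0 < R := by positivity
  rw [h.twoBall_cube hi, h.twoBallDensity_cube hi, ballDensity]
  have h1 : μ (closedBall ((S.net k).z i) R) =
      ENNReal.ofReal R ^ n * (μ (closedBall ((S.net k).z i) R) / ENNReal.ofReal R ^ n) := by
    rw [ENNReal.mul_div_cancel]
    · exact pow_ne_zero _ (by simpa using hR0)
    · exact ENNReal.pow_ne_top ENNReal.ofReal_ne_top
  conv_lhs => rw [h1]
  rw [← mul_assoc, ← mul_pow]
  gcongr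
  rw [← ENNReal.ofReal_mul (by positivity)]
  refine ENNReal.ofReal_le_ofReal ?_
  have h2 : A ^ k * (C₀ * (A ^ k)⁻¹) = C₀ := by field_simp
  have h3 := mul_le_mul_of_nonneg_left hr' (show 0 ≤ A ^ k by positivity)
  rw [h2] at h3
  rw [hR]
  linarith

/-- The term of the cube `P` of generation `m` in the sum `DMLattice.energyDouble`, relative to the
generation `k`. -/
noncomputable def energyTerm (L : DMLattice μ c C₀ A) (n : ℕ) (γ : ℝ) (k : ℕ)
    (P : ℕ × Set (EuclideanSpace ℝ (Fin d))) : ℝ≥0∞ :=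
  ENNReal.ofReal ((L.sideLength P.1 / L.sideLength k) ^ γ) * L.twoBallDensity n P.1 P.2 ^ 2 * μ P.2

theorem sideLength_ratio (hC : 0 < C₀) (hA : 0 < A) (k l : ℕ) :
    ENNReal.ofReal ((L.sideLength (k + l) / L.sideLength k) ^ γ) =
      ENNReal.ofReal (A ^ (-γ)) ^ l := by
  have h : L.sideLength (k + l) / L.sideLength k = (A ^ l)⁻¹ := by
    simp only [DMLattice.sideLength, pow_add]
    field_simp
  rw [h, ← ENNReal.ofReal_pow (by positivity)]
  congr 1
  rw [← Real.rpow_natCast, ← Real.rpow_natCast, ← Real.rpow_neg hA.le, ← Real.rpow_mul hA.le,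
    ← Real.rpow_mul hA.le]
  congr 1
  ring

/-- The ancestor of generation `k` meets 90B(Q), and 90 r(Q) ≤ 90 C₀ A^{-k} < 112 C₀ A^{-k} = 2ℓ(Q).
-/
theorem Represents.cube_mem_cubesInDouble (h : S.Represents L) (hC : 1 < C₀) (hA : 1 < A)
    {k i l j : ℕ} (hi : i < (S.net k).N) (hj : j < (S.net (k + l)).N)
    (hij : (S.cube (k + l) j ∩ (S.net k).bigBall i).Nonempty) :
    (k + l, S.cube (k + l) j) ∈ L.cubesInDouble k (S.cube k i) := by
  have hA0 : 0 < A := by linarith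
  have hC0 : 0 < C₀ := by linarith
  obtain ⟨x, hx, hxi⟩ := hij
  refine ⟨(h.mem_cubes _ _).2 ⟨j, hj, rfl⟩, ?_, ?_⟩
  · intro y hy
    refine ⟨S.cube k (S.φ k x), ⟨(h.mem_cubes _ _).2 ⟨_, S.φ_lt k x hx.1, rfl⟩, ?_⟩, hy.1,
      S.φ_congr (Nat.le_add_right k l) hy.1 hx.1 (hy.2.trans hx.2.symm)⟩
    rw [h.center_cube k i hi, DMLattice.sideLength]
    have h1 : infDist ((S.net k).z i) (S.cube k (S.φ k x)) ≤ dist ((S.net k).z i) x :=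
      infDist_le_dist_of_mem ⟨hx.1, rfl⟩
    have h2 : dist x ((S.net k).z i) ≤ 90 * (S.net k).r i := hxi
    have h3 := (S.net k).r_le i hi
    have h4 : 0 < C₀ * (A ^ k)⁻¹ := by positivity
    rw [dist_comm] at h2
    linarith
  · simp only [DMLattice.sideLength]
    have : (A ^ (k + l))⁻¹ ≤ (A ^ k)⁻¹ :=
      inv_anti₀ (by positivity) (pow_le_pow_right₀ hA.le (by omega))
    gcongr

/-- For x in the cube, B(x, 28 A^{-k}) ⊆ 2B_Q, since x ∈ 28B(Q) and A^{-k} ≤ r(Q). -/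
theorem Represents.scaleMeasure_cube_le (h : S.Represents L) (hA : 1 < A) {k i : ℕ}
    (hi : i < (S.net k).N) :
    scaleMeasure μ n A k (S.cube k i) ≤
      ENNReal.ofReal (56 * C₀) ^ (2 * n) *
        (L.twoBallDensity n k (S.cube k i) ^ 2 * μ (S.cube k i)) := by
  rw [scaleMeasure, withDensity_apply _ (S.measurableSet_cube k i)]
  calc ∫⁻ x in S.cube k i, localDensity μ n A k x ^ 2 ∂μ
      ≤ ∫⁻ _ in S.cube k i,
          (ENNReal.ofReal (56 * C₀) ^ n * L.twoBallDensity n k (S.cube k i)) ^ 2 ∂μ := by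
        refine lintegral_mono_ae ?_
        filter_upwards [ae_restrict_mem (S.measurableSet_cube k i)] with x hx
        gcongr
        refine le_trans ?_ (h.mul_measure_twoBall_le hA hi)
        rw [localDensity, mul_comm, h.twoBall_cube hi]
        refine mul_le_mul' le_rfl (measure_mono (closedBall_subset_closedBall' ?_))
        have h1 : dist x ((S.net k).z i) ≤ 28 * (S.net k).r i := S.cube_subset hx
        linarith [(S.net k).le_r i hi]
    _ = _ := by
        rw [lintegral_const, Measure.restrict_apply MeasurableSet.univ, univ_inter]
        ring

/-- At each scale the cubes meeting 90B(Q) cover its part in the support, and the weight a^l is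
(ℓ(P)/ℓ(Q))^γ. Pairs of generation and index give distinct terms of the energy. -/
theorem Represents.tailMeasure_bigBall_le (h : S.Represents L) (hμ : μ μ.supportᶜ = 0)
    (hC : 1 < C₀) (hA : 1 < A) {k i : ℕ} (hi : i < (S.net k).N) :
    tailMeasure μ n A (ENNReal.ofReal (A ^ (-γ))) k ((S.net k).bigBall i) ≤
      ENNReal.ofReal (56 * C₀) ^ (2 * n) * L.energyDouble n γ k (S.cube k i) := by
  classical
  have hA0 : 0 < A := by linarith
  let T : ℕ → Finset ℕ := fun l => (Finset.range (S.net (k + l)).N).filter fun j =>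
    (S.cube (k + l) j ∩ (S.net k).bigBall i).Nonempty
  have hT : ∀ l, ∀ j ∈ T l, j < (S.net (k + l)).N ∧
      (S.cube (k + l) j ∩ (S.net k).bigBall i).Nonempty := fun l j hj => by
    simpa [T] using hj
  have hcover : ∀ l, scaleMeasure μ n A (k + l) ((S.net k).bigBall i) ≤
      ∑ j ∈ T l, scaleMeasure μ n A (k + l) (S.cube (k + l) j) := by
    intro l
    have hnull : scaleMeasure μ n A (k + l) μ.supportᶜ = 0 :=
      withDensity_absolutelyContinuous _ _ hμ
    have hsub : (S.net k).bigBall i ⊆ (⋃ j ∈ T l, S.cube (k + l) j) ∪ μ.supportᶜ := by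
      intro x hx
      by_cases hxE : x ∈ μ.support
      · refine Or.inl (mem_iUnion₂.2 ⟨S.φ (k + l) x, ?_, hxE, rfl⟩)
        exact Finset.mem_filter.2 ⟨Finset.mem_range.2 (S.φ_lt _ x hxE), x, ⟨hxE, rfl⟩, hx⟩
      · exact Or.inr hxE
    refine (measure_mono hsub).trans ((measure_union_le _ _).trans ?_)
    rw [hnull, add_zero]
    exact measure_biUnion_finset_le _ _
  have hterm : ∀ l, ∀ j ∈ T l, ENNReal.ofReal (A ^ (-γ)) ^ l *
      scaleMeasure μ n A (k + l) (S.cube (k + l) j) ≤ ENNReal.ofReal (56 * C₀) ^ (2 * n) *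
        energyTerm L n γ k (k + l, S.cube (k + l) j) := by
    intro l j hj
    have h1 := h.scaleMeasure_cube_le (n := n) hA (hT l j hj).1
    calc _ ≤ ENNReal.ofReal (A ^ (-γ)) ^ l * (ENNReal.ofReal (56 * C₀) ^ (2 * n) *
        (L.twoBallDensity n (k + l) (S.cube (k + l) j) ^ 2 * μ (S.cube (k + l) j))) := by gcongr
      _ = _ := by
        rw [energyTerm, sideLength_ratio (by linarith) hA0]
        ring
  let e : (Σ l, T l) → L.cubesInDouble k (S.cube k i) := fun p =>
    ⟨(k + p.1, S.cube (k + p.1) p.2), h.cube_mem_cubesInDouble hC hA hi (hT _ _ p.2.2).1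
      (hT _ _ p.2.2).2⟩
  have he : Function.Injective e := by
    rintro ⟨l, j, hj⟩ ⟨l', j', hj'⟩ hp
    have hp' := congrArg Subtype.val hp
    obtain rfl : l = l' := by
      have := congrArg Prod.fst hp'
      simp only [e] at this
      omega
    obtain rfl : j = j' := S.cube_injective hA0 (hT l j hj).1 (congrArg Prod.snd hp')
    rfl
  calc tailMeasure μ n A (ENNReal.ofReal (A ^ (-γ))) k ((S.net k).bigBall i)
      = ∑' l, ENNReal.ofReal (A ^ (-γ)) ^ l *
          scaleMeasure μ n A (k + l) ((S.net k).bigBall i) :=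
        tailMeasure_apply isClosed_closedBall.measurableSet
    _ ≤ ∑' l, ∑' j : T l, ENNReal.ofReal (56 * C₀) ^ (2 * n) *
        energyTerm L n γ k (k + l, S.cube (k + l) j) := by
        refine ENNReal.tsum_le_tsum fun l => ?_
        rw [Finset.tsum_subtype (T l) fun j => ENNReal.ofReal (56 * C₀) ^ (2 * n) *
          energyTerm L n γ k (k + l, S.cube (k + l) j)]
        refine (mul_le_mul' le_rfl (hcover l)).trans ?_
        rw [Finset.mul_sum]
        exact Finset.sum_le_sum fun j hj => hterm l j hj
    _ = ENNReal.ofReal (56 * C₀) ^ (2 * n) * ∑' p : Σ l, T l, energyTerm L n γ k (e p) := by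
        rw [← ENNReal.tsum_mul_left, ENNReal.tsum_sigma']
    _ ≤ ENNReal.ofReal (56 * C₀) ^ (2 * n) *
        ∑' P : L.cubesInDouble k (S.cube k i), energyTerm L n γ k P := by
        gcongr
        exact ENNReal.tsum_comp_le_tsum_of_injective he fun P => energyTerm L n γ k P

theorem Represents.le_energyDouble (h : S.Represents L) (hC : 1 < C₀) (hA : 1 < A) {k i : ℕ}
    (hi : i < (S.net k).N) :
    L.twoBallDensity n k (S.cube k i) ^ 2 * μ (S.cube k i) ≤
      L.energyDouble n γ k (S.cube k i) := by
  have hA0 : 0 < A := by linarith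
  have hr : 0 ≤ (S.net k).r i := le_trans (by positivity) ((S.net k).le_r i hi)
  have hmem := h.cube_mem_cubesInDouble hC hA (l := 0) hi hi
    ⟨_, S.center_mem_cube hA0 hi, mem_closedBall_self (by positivity)⟩
  have hle := ENNReal.le_tsum (f := fun P : L.cubesInDouble k (S.cube k i) => energyTerm L n γ k P)
    ⟨_, hmem⟩
  refine le_trans (le_of_eq ?_) hle
  rw [energyTerm, sideLength_ratio (by linarith) hA0]
  simp

/-- Growth bounds all densities by θ₀ and cubes of one generation are disjoint, so a geometric
series of ratio A^{-γ} < 1 dominates. -/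
theorem Represents.energyDouble_lt_top [IsFiniteMeasure μ] (h : S.Represents L)
    (hgrowth : HasPolynomialGrowth μ n) (hC : 1 < C₀) (hA : 1 < A) (hγ : 0 < γ) (k i : ℕ) :
    L.energyDouble n γ k (S.cube k i) < ∞ := by
  have hA0 : 0 < A := by linarith
  have hC0 : 0 < C₀ := by linarith
  obtain ⟨θ, hθ⟩ := hgrowth
  set a := ENNReal.ofReal (A ^ (-γ)) with ha
  have ha1 : a < 1 := by
    rw [ha, ENNReal.ofReal_lt_one]
    exact Real.rpow_lt_one_of_one_lt_of_neg hA (by linarith)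
  let g : ℕ × ℕ → ℝ≥0∞ := fun p => a ^ p.1 * (θ ^ 2 * μ (S.cube (k + p.1) p.2))
  have hidx : ∀ P : L.cubesInDouble k (S.cube k i), k ≤ P.1.1 ∧
      ∃ j < (S.net P.1.1).N, P.1.2 = S.cube P.1.1 j := by
    rintro ⟨⟨m, P⟩, hP1, -, hP2⟩
    refine ⟨?_, (h.mem_cubes _ _).1 hP1⟩
    by_contra hlt
    have h1 : A ^ m < A ^ k := pow_lt_pow_right₀ hA (not_le.1 hlt)
    have h2 : (A ^ k)⁻¹ < (A ^ m)⁻¹ := inv_strictAnti₀ (by positivity) h1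
    simp only [DMLattice.sideLength] at hP2
    have h3 : 56 * C₀ * (A ^ k)⁻¹ < 56 * C₀ * (A ^ m)⁻¹ := by gcongr
    linarith
  choose hk J hJ hPJ using hidx
  let e : L.cubesInDouble k (S.cube k i) → ℕ × ℕ := fun P => (P.1.1 - k, J P)
  have he : Function.Injective e := by
    intro P P' hp
    obtain ⟨h1, h2⟩ := Prod.mk.inj hp
    have h3 : P.1.1 = P'.1.1 := by have := hk P; have := hk P'; omega
    refine Subtype.ext (Prod.ext h3 ?_)
    rw [hPJ P, hPJ P', h3, h2]
  have hle : ∀ P : L.cubesInDouble k (S.cube k i), energyTerm L n γ k P ≤ g (e P) := by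
    intro P
    have hm : k + (P.1.1 - k) = P.1.1 := Nat.add_sub_of_le (hk P)
    have hden : L.twoBallDensity n P.1.1 P.1.2 ≤ θ := by
      rw [hPJ P, h.twoBallDensity_cube (hJ P), ballDensity]
      refine ENNReal.div_le_of_le_mul (hθ _ ((S.net _).z_mem _ (hJ P)) _ ?_)
      have : 0 < (S.net P.1.1).r (J P) := lt_of_lt_of_le (by positivity) ((S.net _).le_r _ (hJ P))
      positivity
    have hrat := sideLength_ratio (L := L) (γ := γ) hC0 hA0 k (P.1.1 - k)
    rw [hm] at hrat
    simp only [energyTerm, g, e, hm, ← hPJ P]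
    rw [hrat, mul_assoc]
    gcongr
  calc L.energyDouble n γ k (S.cube k i) ≤ ∑' P, g (e P) := ENNReal.tsum_le_tsum hle
    _ ≤ ∑' p, g p := ENNReal.tsum_comp_le_tsum_of_injective he g
    _ = ∑' m, ∑' j, g (m, j) := ENNReal.tsum_prod (f := fun m j => g (m, j))
    _ ≤ ∑' m, a ^ m * (θ ^ 2 * μ univ) := by
        refine ENNReal.tsum_le_tsum fun m => ?_
        simp only [g, ENNReal.tsum_mul_left]
        gcongr
        rw [← measure_iUnion (fun j j' hjj' => Set.disjoint_left.2 fun x hx hx' =>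
          hjj' (hx.2.symm.trans hx'.2)) fun j => S.measurableSet_cube _ j]
        exact measure_mono (subset_univ _)
    _ < ∞ := by
        rw [ENNReal.tsum_mul_right, ENNReal.tsum_geometric]
        refine ENNReal.mul_lt_top (ENNReal.inv_lt_top.2 (tsub_pos_of_lt ha1))
          (ENNReal.mul_lt_top ?_ (measure_lt_top _ _))
        exact ENNReal.pow_lt_top ENNReal.coe_lt_top

theorem Represents.interaction_le_energyDouble [IsFiniteMeasure μ] (h : S.Represents L)
    (hC : 1 < C₀) (hA : 1 < A) {b : ℝ≥0∞} (hb : 2 ≤ b)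
    (hab : 2 * b * ENNReal.ofReal (c * C₀ ^ (3 * d + 1) / A) ≤ ENNReal.ofReal (A ^ (-γ)))
    {ν : ℕ → Bool → Measure (EuclideanSpace ℝ (Fin d))} (hS : S.SmallSteps c ν)
    (hν : ∀ k, ν k false = tailMeasure μ n A (ENNReal.ofReal (A ^ (-γ))) k)
    {k i : ℕ} (hi : i < (S.net k).N) :
    interaction μ n (L.twoBall k (S.cube k i) \ S.cube k i) (S.cube k i) +
      interaction μ n (S.cube k i) (L.twoBall k (S.cube k i) \ S.cube k i) ≤
      (4 + 16 * ENNReal.ofReal A ^ (2 * n)) * ENNReal.ofReal (56 * C₀) ^ (2 * n) *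
        L.energyDouble n γ k (S.cube k i) := by
  have hA0 : 0 < A := by linarith
  have hμ : μ μ.supportᶜ = 0 := Measure.measure_compl_support
  set Q := S.cube k i with hQ
  set V := L.twoBall k Q with hV
  set D := ENNReal.ofReal (56 * C₀) ^ (2 * n) with hD
  have hQm : MeasurableSet Q := S.measurableSet_cube k i
  have hVm : MeasurableSet V := isClosed_closedBall.measurableSet
  have hQV : Q ⊆ V := by
    rw [hV, h.twoBall_cube hi]
    refine S.cube_subset.trans (closedBall_subset_closedBall ?_)
    have : 0 ≤ (S.net k).r i := le_trans (by positivity) ((S.net k).le_r i hi)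
    linarith
  have h1 := interaction_le (n := n) (S := S) hμ hA hb (k := k) (i := i) (hVm.diff hQm) hQm
    fun x hx y hy => ⟨fun hxy => hx.1.2 (hxy ▸ hy.1), fun l hl =>
      mem_boundaryLayer_iff.2 (Or.inl ⟨⟨hx.2, hx.1.2⟩, y, hy.1, hl⟩)⟩
  have h2 := interaction_le (n := n) (S := S) hμ hA hb (k := k) (i := i) hQm (hVm.diff hQm)
    fun x hx y hy => ⟨fun hxy => hy.1.2 (hxy ▸ hx.1), fun l hl =>
      mem_boundaryLayer_iff.2 (Or.inr ⟨hx.1, y, ⟨hy.2, hy.1.2⟩, hl⟩)⟩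
  have ha0 : ENNReal.ofReal (A ^ (-γ)) ≠ 0 := by
    simpa using Real.rpow_pos_of_pos hA0 (-γ)
  have htail := (tsum_scaleMeasure_layer_le hA.le hS hν ha0 ENNReal.ofReal_ne_top hab hi).trans
    (mul_le_mul' le_rfl (h.tailMeasure_bigBall_le (n := n) (γ := γ) hμ hC hA hi))
  have htop : (ENNReal.ofReal (A ^ k) ^ n * μ V) ^ 2 * μ Q ≤ D * L.energyDouble n γ k Q := by
    calc _ ≤ (ENNReal.ofReal (56 * C₀) ^ n * L.twoBallDensity n k Q) ^ 2 * μ Q := by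
          exact mul_le_mul' (pow_le_pow_left' (h.mul_measure_twoBall_le hA hi) 2) le_rfl
      _ = D * (L.twoBallDensity n k Q ^ 2 * μ Q) := by rw [hD]; ring
      _ ≤ _ := by gcongr; exact h.le_energyDouble hC hA hi
  have hQV' : μ Q ≤ μ V := measure_mono hQV
  have hVQ : μ (V \ Q) ≤ μ V := measure_mono sdiff_subset
  -- One of the factors μ(Q) in the square is kept as the mass to be summed, because the energy term
  -- of Q controls θ² μ(Q) and not θ² μ(V).
  have hfirst : (ENNReal.ofReal (A ^ k) ^ n * μ Q) ^ 2 * μ (V \ Q) ≤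
      (ENNReal.ofReal (A ^ k) ^ n * μ V) ^ 2 * μ Q := by
    calc _ = ENNReal.ofReal (A ^ k) ^ (2 * n) * (μ Q * μ (V \ Q) * μ Q) := by ring
      _ ≤ ENNReal.ofReal (A ^ k) ^ (2 * n) * (μ V * μ V * μ Q) := by gcongr
      _ = _ := by ring
  have hsecond : (ENNReal.ofReal (A ^ k) ^ n * μ (V \ Q)) ^ 2 * μ Q ≤
      (ENNReal.ofReal (A ^ k) ^ n * μ V) ^ 2 * μ Q := by gcongr
  calc _ ≤ (2 * (D * L.energyDouble n γ k Q) +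
          4 * ENNReal.ofReal A ^ (2 * n) * (2 * (D * L.energyDouble n γ k Q))) +
        (2 * (D * L.energyDouble n γ k Q) +
          4 * ENNReal.ofReal A ^ (2 * n) * (2 * (D * L.energyDouble n γ k Q))) := by
        refine add_le_add (h1.trans ?_) (h2.trans ?_)
        · exact add_le_add (mul_le_mul' le_rfl (hfirst.trans htop)) (mul_le_mul' le_rfl htail)
        · exact add_le_add (mul_le_mul' le_rfl (hsecond.trans htop)) (mul_le_mul' le_rfl htail)
    _ = _ := by ring

end CubeSystem

/-! ### Choice of the parameters and conclusion. -/

/-- A choice of the lower bound for `A` making the gain of the small boundaries absorb the losses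
of powers of `A`. -/
theorem exists_nat_forall_mul_pow_le_rpow {ε c : ℝ} (hε : 0 < ε) (hc : 0 < c) (m : ℕ) :
    ∃ K : ℕ, ∀ A C₀ : ℝ, 1 < C₀ → K * C₀ ^ K ≤ A → c * C₀ ^ m ≤ A ^ ε := by
  obtain ⟨K, hK⟩ := exists_nat_ge (max (c ^ ε⁻¹) (m / ε))
  refine ⟨K, fun A C₀ hC hA => ?_⟩
  have hC0 : 0 < C₀ := by linarith
  have h1 : c ≤ (K : ℝ) ^ ε := by
    have h := Real.rpow_le_rpow (by positivity) ((le_max_left _ _).trans hK) hε.le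
    rwa [← Real.rpow_mul hc.le, inv_mul_cancel₀ hε.ne', Real.rpow_one] at h
  have h2 : C₀ ^ m ≤ (C₀ ^ K) ^ ε := by
    have h := (le_max_right _ _).trans hK
    rw [div_le_iff₀ hε] at h
    rw [← Real.rpow_natCast, ← Real.rpow_natCast, ← Real.rpow_mul hC0.le]
    exact Real.rpow_le_rpow_of_exponent_le hC.le h
  calc c * C₀ ^ m ≤ (K : ℝ) ^ ε * (C₀ ^ K) ^ ε := by gcongr
    _ = (K * C₀ ^ K) ^ ε := (Real.mul_rpow (by positivity) (by positivity)).symm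
    _ ≤ A ^ ε := Real.rpow_le_rpow (by positivity) hA hε.le

theorem lemma2p5 (d : ℕ) :
    ∃ c : ℝ, 0 < c ∧ ∀ (n : ℕ) (γ : ℝ), 0 < γ → γ < 1 →
      ∃ K : ℕ, ∀ A₀ : ℝ, ∃ C : ℝ≥0, ∀ C₀ : ℝ, 1 < C₀ → 5000 * C₀ < A₀ → K * C₀ ^ K ≤ A₀ →
        ∀ μ : Measure (EuclideanSpace ℝ (Fin d)), IsLocallyFiniteMeasure μ →
          IsCompact μ.support → HasPolynomialGrowth μ n →
          ∃ L : DMLattice μ c C₀ A₀, ∀ k : ℕ, ∀ Q ∈ L.cubes k,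
            interaction μ n (L.twoBall k Q \ Q) Q + interaction μ n Q (L.twoBall k Q \ Q) ≤
                C * L.energyDouble n γ k Q ∧
              L.energyDouble n γ k Q < ∞ := by
  set c : ℝ := 4800 * 1900 ^ d with hc
  have hc1 : 1 ≤ c := by
    have : (1 : ℝ) ≤ 1900 ^ d := one_le_pow₀ (by norm_num)
    linarith
  refine ⟨c, by linarith, fun n γ hγ0 hγ1 => ?_⟩
  -- The gain A^{1-γ} is split evenly: one A^ε serves as the weight b, the other absorbs 2c
  -- C₀^{3d+1}.
  set ε := (1 - γ) / 2 with hε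
  obtain ⟨K, hK⟩ := exists_nat_forall_mul_pow_le_rpow (ε := ε) (c := 2 * c) (by linarith)
    (by linarith) (3 * d + 1)
  -- `56 * A` replaces `56 * C₀`, so that the constant is chosen before C₀.
  refine ⟨K, fun A => ⟨(4 + 16 * A.toNNReal ^ (2 * n)) * (56 * A).toNNReal ^ (2 * n),
    fun C₀ hC hA hKA μ hμ hcpt hgrowth => ?_⟩⟩
  have hA1 : 1 < A := by linarith
  have hA0 : 0 < A := by linarith
  have hC0 : 0 < C₀ := by linarith
  have : IsFiniteMeasure μ := by
    refine ⟨?_⟩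
    rw [← measure_add_measure_compl (Measure.isClosed_support (μ := μ)).measurableSet,
      Measure.measure_compl_support, add_zero]
    exact hcpt.measure_lt_top
  have hpow := hK A C₀ hC hKA
  have hb : (2 : ℝ≥0∞) ≤ ENNReal.ofReal (A ^ ε) := by
    rw [show (2 : ℝ≥0∞) = ENNReal.ofReal 2 by simp]
    refine ENNReal.ofReal_le_ofReal (le_trans ?_ hpow)
    have : (1 : ℝ) ≤ C₀ ^ (3 * d + 1) := one_le_pow₀ hC.le
    nlinarith
  have hab : 2 * ENNReal.ofReal (A ^ ε) * ENNReal.ofReal (c * C₀ ^ (3 * d + 1) / A) ≤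
      ENNReal.ofReal (A ^ (-γ)) := by
    have h2 : (2 : ℝ≥0∞) * ENNReal.ofReal (A ^ ε) = ENNReal.ofReal (2 * A ^ ε) := by
      rw [ENNReal.ofReal_mul (by norm_num)]
      simp
    rw [h2, ← ENNReal.ofReal_mul (by positivity)]
    refine ENNReal.ofReal_le_ofReal ?_
    calc 2 * A ^ ε * (c * C₀ ^ (3 * d + 1) / A) = A ^ ε * (2 * c * C₀ ^ (3 * d + 1)) / A := by ring
      _ ≤ A ^ ε * A ^ ε / A := by gcongr
      _ = A ^ (-γ) := by
        rw [← Real.rpow_add hA0, ← Real.rpow_sub_one hA0.ne']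
        congr 1
        rw [hε]
        ring
  -- The component `true` yields the small boundaries of the lattice, the component `false` the
  -- energy estimate.
  obtain ⟨S, hS⟩ := CubeSystem.exists_smallSteps hC hA hcpt fun k q =>
    bif q then μ else tailMeasure μ n A (ENNReal.ofReal (A ^ (-γ))) k
  have hsmall := fun k i hi l => CubeSystem.measure_layer_le hA1.le hS (fun _ => rfl) l k i hi
  have hL := S.represents_toDMLattice hA1.le hsmall hC0.le (by positivity)
  refine ⟨S.toDMLattice hA1.le hsmall hC0.le (by positivity), ?_⟩
  rintro k _ ⟨i, hi, rfl⟩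
  refine ⟨(hL.interaction_le_energyDouble hC hA1 hb hab hS (fun _ => rfl) hi).trans ?_,
    hL.energyDouble_lt_top hgrowth hC hA1 hγ0 k i⟩
  gcongr
  push_cast
  change (4 + 16 * ENNReal.ofReal A ^ (2 * n)) * ENNReal.ofReal (56 * C₀) ^ (2 * n) ≤
    (4 + 16 * ENNReal.ofReal A ^ (2 * n)) * ENNReal.ofReal (56 * A) ^ (2 * n)
  gcongr
  linarith
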